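/- Let $J,R,Q\in\mathbb R^{n,n}$ with $J^T=-J$, $R^T=R\succeq 0$ and $Q^T=Q\succ 0$, and suppose that the real dissipative Hamiltonian (DH) system $\dot x(t)=(J-R)Qx(t)$ is asymptotically stable, i.e. its equilibrium $0$ is Lyapunov stable and all trajectories starting sufficiently close to $0$ tend to $0$ as $t\to\infty$. Let $B\in\mathbb R^{n,r}$ and $C\in\mathbb R^{q,n}$. Write $\Lambda(A)$ for the set of complex eigenvalues of a square matrix $A$, $\|\cdot\|_F$ for the Frobenius norm and $\|\cdot\|_2$ for the spectral norm. Define the real unstructured stability radius \[ r_{\mathbb R}(J,R;B,C)=\inf\Big\{\sqrt{\|\Delta_J\|_F^2+\|\Delta_R\|_F^2}\;:\;\Delta_J,\Delta_R\in\mathbb R^{r,q},\ \Lambda\big((J-R)Q+B(\Delta_J-\Delta_R)CQ\big)\cap i\mathbb R\neq\emptyset\Big\}, \] for $M\in\mathbb C^{p,m}$ define \[ \mu_{\mathbb R,2}(M)=\Big(\inf\big\{\|\Delta\|_2:\ \Delta\in\mathbb R^{m,p},\ \det(I_m-\Delta M)=0\big\}\Big)^{-1}, \] and for $w\in\mathbb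 R$ let $G(w)=CQ\,(iwI_n-(J-R)Q)^{-1}B$. Here $\inf\emptyset=+\infty$, $(+\infty)^{-1}=0$ and $0^{-1}=+\infty$. Then \[ \frac1{\sqrt2}\,\inf_{w\in\mathbb R}\mu_{\mathbb R,2}(G(w))^{-1}\ \le\ r_{\mathbb R}(J,R;B,C)\ \le\ \inf_{w\in\mathbb R}\mu_{\mathbb R,2}(G(w))^{-1}, \] and for every $w\in\mathbb R$ \[ \mu_{\mathbb R,2}(G(w))=\inf_{\gamma\in(0,1]}\sigma_2\begin{pmatrix}\operatorname{Re}G(w)&-\gamma\operatorname{Im}G(w)\\ \gamma^{-1}\operatorname{Im}G(w)&\operatorname{Re}G(w)\end{pmatrix}, \] where $\sigma_2(A)$ denotes the second largest singular value of $A$, counted with multiplicity ($\sigma_2(A)=0$ for an empty matrix $A$). -/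

import Mathlib

open scoped ENNReal

/-- `x` solves the linear time-invariant system `ẋ = A x` on `[t₀, ∞)`. -/
def IsTrajectory {n : ℕ} (A : Matrix (Fin n) (Fin n) ℝ) (t₀ : ℝ)
    (x : ℝ → EuclideanSpace ℝ (Fin n)) : Prop :=
  ∀ t, t₀ ≤ t → HasDerivWithinAt x (Matrix.toEuclideanLin A (x t)) (Set.Ici t₀) t

/-- Asymptotic stability (in the sense of Lyapunov) of the equilibrium `0` of `ẋ = A x`. -/
def IsAsymptoticallyStable {n : ℕ} (A : Matrix (Fin n) (Fin n) ℝ) : Prop :=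
  ∀ t₀ : ℝ,
    (∀ ε : ℝ, 0 < ε → ∃ δ : ℝ, 0 < δ ∧ ∀ x : ℝ → EuclideanSpace ℝ (Fin n),
      IsTrajectory A t₀ x → ‖x t₀‖ < δ → ∀ t, t₀ < t → ‖x t‖ < ε) ∧
    (∃ δ : ℝ, 0 < δ ∧ ∀ x : ℝ → EuclideanSpace ℝ (Fin n),
      IsTrajectory A t₀ x → ‖x t₀‖ < δ → Filter.Tendsto x Filter.atTop (nhds 0))

/-- A real matrix regarded as a complex matrix. -/
def complexify {k l : ℕ} (A : Matrix (Fin k) (Fin l) ℝ) : Matrix (Fin k) (Fin l) ℂ :=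
  A.map Complex.ofReal

/-- The set `Λ(A)` of all (complex) eigenvalues of a complex square matrix. -/
def eigenvalueSet {n : ℕ} (A : Matrix (Fin n) (Fin n) ℂ) : Set ℂ :=
  {z | Module.End.HasEigenvalue (Matrix.toLin' A) z}

/-- The imaginary axis `iℝ`. -/
def imaginaryAxis : Set ℂ := Set.range fun w : ℝ => Complex.I * (w : ℂ)

open scoped Matrix.Norms.Frobenius in
/-- The Frobenius norm of a real matrix. -/
noncomputable def frobeniusNorm {k l : ℕ} (A : Matrix (Fin k) (Fin l) ℝ) : ℝ := ‖A‖

open scoped Matrix.Norms.L2Operator in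
/-- The spectral norm of a real matrix. -/
noncomputable def matrixSpectralNorm {k l : ℕ} (A : Matrix (Fin k) (Fin l) ℝ) : ℝ := ‖A‖

/-- The real unstructured stability radius `r_ℝ(J,R;B,C)` of `ẋ = (J - R) Q x`, with value `∞` if
no admissible perturbation exists. -/
noncomputable def realUnstructuredRadius {n r q : ℕ} (J R Q : Matrix (Fin n) (Fin n) ℝ)
    (B : Matrix (Fin n) (Fin r) ℝ) (C : Matrix (Fin q) (Fin n) ℝ) : ℝ≥0∞ :=
  sInf {d : ℝ≥0∞ | ∃ ΔJ ΔR : Matrix (Fin r) (Fin q) ℝ,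
    (eigenvalueSet (complexify ((J - R) * Q + B * (ΔJ - ΔR) * C * Q)) ∩ imaginaryAxis).Nonempty ∧
    d = ENNReal.ofReal (Real.sqrt (frobeniusNorm ΔJ ^ 2 + frobeniusNorm ΔR ^ 2))}

/-- The real structured singular value
`μ_{ℝ,2}(M) = (inf {‖Δ‖₂ : Δ ∈ ℝ^{m,p}, det (I_m - Δ M) = 0})⁻¹` of `M ∈ ℂ^{p,m}`, where
`inf ∅ = ∞` and `∞⁻¹ = 0`. -/
noncomputable def muRealTwo {p m : ℕ} (M : Matrix (Fin p) (Fin m) ℂ) : ℝ≥0∞ :=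
  (sInf {d : ℝ≥0∞ | ∃ Δ : Matrix (Fin m) (Fin p) ℝ,
    (1 - complexify Δ * M).det = 0 ∧ d = ENNReal.ofReal (matrixSpectralNorm Δ)})⁻¹

/-- The second largest singular value (counted with multiplicity) of a real matrix;
Mathlib counts singular values from `0`. -/
noncomputable def secondSingularValue {ι κ : Type*} [Fintype ι] [Fintype κ] [DecidableEq κ]
    (A : Matrix ι κ ℝ) : ℝ :=
  (Matrix.toEuclideanLin A).singularValues 1

/-- The real block matrix `[Re M, -γ Im M; γ⁻¹ Im M, Re M]`. -/
noncomputable def realBlockMatrix {p m : ℕ} (M : Matrix (Fin p) (Fin m) ℂ) (γ : ℝ) :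
    Matrix (Fin p ⊕ Fin p) (Fin m ⊕ Fin m) ℝ :=
  Matrix.fromBlocks (M.map Complex.re) (-(γ • M.map Complex.im))
    (γ⁻¹ • M.map Complex.im) (M.map Complex.re)

/-- The transfer function `G(w) = C Q (i w I_n - (J - R) Q)⁻¹ B`. -/
noncomputable def transferFunction {n r q : ℕ} (J R Q : Matrix (Fin n) (Fin n) ℝ)
    (B : Matrix (Fin n) (Fin r) ℝ) (C : Matrix (Fin q) (Fin n) ℝ) (w : ℝ) :
    Matrix (Fin q) (Fin r) ℂ :=
  complexify C * complexify Q *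
    ((Complex.I * (w : ℂ)) • (1 : Matrix (Fin n) (Fin n) ℂ) - complexify ((J - R) * Q))⁻¹ *
    complexify B

/-! Stability keeps the imaginary axis free of eigenvalues of `(J - R) * Q`, so Sylvester's
determinant identity turns "`i w` is an eigenvalue of the perturbed matrix" into `det (1 - Δ G(w)) =
0` with `Δ = ΔJ - ΔR`. The lower bound follows from `‖Δ‖₂ ≤ ‖Δ‖_F` and `‖ΔJ - ΔR‖_F² ≤ 2 (‖ΔJ‖_F² +
‖ΔR‖_F²)`. For the upper bound, only the values of `Δ` on the real and imaginary parts of one vector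
matter, so `Δ` may be taken of rank at most two with `‖Δ‖_F ≤ √2 ‖Δ‖₂`; the split `ΔJ = -ΔR = Δ/2`
then gains the factor `1/√2` back.

For the formula for `μ`, identify `a + i b` with `(a, b)`. The block matrix at `γ = 1` is a
complex-linear map `P`, and the one at `γ` is its conjugate by the scaling `(a, b) ↦ (γ a, b)`. A
singularizing `Δ` gives a real plane, stable under multiplication by `i`, whose scaled copies bound
every `σ₂` from below by `‖Δ‖₂⁻¹`.

Conversely, suppose that `σ ≤ σ₂` for all `γ`. With `K` the conjugation, put `A = P*P - σ²` and `S =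
P*KP - σ²K`; then each form `A - t S`, `0 ≤ t < 1`, is nonnegative on a plane. Minimizing the second
eigenvalue over `t` and perturbing at the minimum yields a vector where `A` dominates the modulus of
the complex quadratic form of `S` (`exists_abs_inner_le_inner`). There a Gram matrix inequality
holds, which is what a real `Δ` with `‖Δ‖₂ ≤ σ⁻¹` needs. -/

/-! ### Variational description and perturbation of the second eigenvalue -/

section SecondEigenvalue

variable {V : Type*} [NormedAddCommGroup V] [InnerProductSpace ℝ V] [FiniteDimensional ℝ V]

open scoped RealInnerProductSpace

/-- A subspace of dimension at least two meets every hyperplane nontrivially. -/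
theorem exists_ne_zero_inner_eq_zero {W : Submodule ℝ V} (hW : 2 ≤ Module.finrank ℝ W) (u : V) :
    ∃ x ∈ W, x ≠ 0 ∧ ⟪u, x⟫ = 0 := by
  have hlt : Module.finrank ℝ ℝ < Module.finrank ℝ W := by
    rw [Module.finrank_self]; omega
  have hker := LinearMap.ker_ne_bot_of_finrank_lt
    (f := ((innerSL ℝ u).toLinearMap).comp W.subtype) hlt
  obtain ⟨x, hx, hx0⟩ := Submodule.exists_mem_ne_zero_of_ne_bot hker
  exact ⟨x, x.2, by simpa using hx0, by simpa using hx⟩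

variable {T T' : V →ₗ[ℝ] V} {n : ℕ}

theorem inner_apply_self_eq_sum (hT : T.IsSymmetric) (hn : Module.finrank ℝ V = n) (x : V) :
    ⟪x, T x⟫ = ∑ i, hT.eigenvalues hn i * ⟪hT.eigenvectorBasis hn i, x⟫ ^ 2 := by
  rw [← (hT.eigenvectorBasis hn).sum_inner_mul_inner x (T x)]
  refine Finset.sum_congr rfl fun i _ => ?_
  rw [← hT, hT.apply_eigenvectorBasis, real_inner_comm x]
  simp only [RCLike.ofReal_real_eq_id, id, real_inner_smul_right,
    real_inner_comm x]
  ring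

theorem norm_sq_eq_sum (hT : T.IsSymmetric) (hn : Module.finrank ℝ V = n) (x : V) :
    ‖x‖ ^ 2 = ∑ i, ⟪hT.eigenvectorBasis hn i, x⟫ ^ 2 := by
  rw [← real_inner_self_eq_norm_sq, ← (hT.eigenvectorBasis hn).sum_inner_mul_inner x x]
  refine Finset.sum_congr rfl fun i _ => ?_
  rw [real_inner_comm x, sq]

theorem inner_apply_self_sub (hT : T.IsSymmetric) (hn : Module.finrank ℝ V = n) (x : V) (c : ℝ) :
    c * ‖x‖ ^ 2 - ⟪x, T x⟫ =
      ∑ i, (c - hT.eigenvalues hn i) * ⟪hT.eigenvectorBasis hn i, x⟫ ^ 2 := by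
  rw [norm_sq_eq_sum hT hn, inner_apply_self_eq_sum hT hn, Finset.mul_sum,
    ← Finset.sum_sub_distrib]
  exact Finset.sum_congr rfl fun i _ => by ring

/-- Equality case of the Rayleigh bound: `c ‖x‖² - ⟪x, T x⟫` is a sum of nonnegative terms, so each
of them vanishes. -/
theorem apply_eq_smul_of_inner_apply_self_eq (hT : T.IsSymmetric) (hn : Module.finrank ℝ V = n)
    {x : V} {c : ℝ}
    (hc : ∀ i, ⟪hT.eigenvectorBasis hn i, x⟫ = 0 ∨ hT.eigenvalues hn i ≤ c)
    (heq : ⟪x, T x⟫ = c * ‖x‖ ^ 2) : T x = c • x := by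
  have hsum := inner_apply_self_sub hT hn x c
  rw [heq, sub_self, eq_comm, Finset.sum_eq_zero_iff_of_nonneg] at hsum
  · refine InnerProductSpace.ext_inner_left_basis (𝕜 := ℝ)
      (hT.eigenvectorBasis hn).toBasis fun i => ?_
    rw [OrthonormalBasis.coe_toBasis, ← hT, hT.apply_eigenvectorBasis, real_inner_smul_right]
    simp only [RCLike.ofReal_real_eq_id, id, real_inner_smul_left]
    rcases mul_eq_zero.1 (hsum i (Finset.mem_univ i)) with h | h
    · rw [sub_eq_zero.1 h]
    · rw [pow_eq_zero_iff two_ne_zero] at h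
      rw [h]; simp
  · intro i _
    rcases hc i with h | h
    · rw [h]; simp
    · exact mul_nonneg (sub_nonneg.2 h) (sq_nonneg _)

theorem inner_eq_zero_or_eigenvalue_le (hT : T.IsSymmetric) (hn : Module.finrank ℝ V = n)
    (h1 : 1 < n) {x : V} (hx : ⟪hT.eigenvectorBasis hn ⟨0, by omega⟩, x⟫ = 0) (i : Fin n) :
    ⟪hT.eigenvectorBasis hn i, x⟫ = 0 ∨ hT.eigenvalues hn i ≤ hT.eigenvalues hn ⟨1, h1⟩ := by
  rcases Nat.eq_zero_or_pos i.1 with h | h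
  · have : i = ⟨0, by omega⟩ := Fin.ext h
    exact Or.inl (this ▸ hx)
  · exact Or.inr (hT.eigenvalues_antitone hn (Fin.mk_le_of_le_val h))

theorem inner_apply_self_le_of_inner_eq_zero (hT : T.IsSymmetric) (hn : Module.finrank ℝ V = n)
    (h1 : 1 < n) {x : V} (hx : ⟪hT.eigenvectorBasis hn ⟨0, by omega⟩, x⟫ = 0) :
    ⟪x, T x⟫ ≤ hT.eigenvalues hn ⟨1, h1⟩ * ‖x‖ ^ 2 := by
  rw [← sub_nonneg, inner_apply_self_sub hT hn]
  refine Finset.sum_nonneg fun i _ => ?_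
  rcases inner_eq_zero_or_eigenvalue_le hT hn h1 hx i with h | h
  · rw [h]; simp
  · exact mul_nonneg (sub_nonneg.2 h) (sq_nonneg _)

/-- One half of Courant–Fischer: the plane meets the hyperplane orthogonal to the top eigenvector,
where the second eigenvalue bounds the form. -/
theorem le_second_eigenvalue (hT : T.IsSymmetric) (hn : Module.finrank ℝ V = n) (h1 : 1 < n)
    {c : ℝ} {W : Submodule ℝ V} (hW : 2 ≤ Module.finrank ℝ W)
    (hc : ∀ x ∈ W, c * ‖x‖ ^ 2 ≤ ⟪x, T x⟫) : c ≤ hT.eigenvalues hn ⟨1, h1⟩ := by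
  obtain ⟨x, hxW, hx0, hx⟩ :=
    exists_ne_zero_inner_eq_zero hW (hT.eigenvectorBasis hn ⟨0, by omega⟩)
  have := (hc x hxW).trans (inner_apply_self_le_of_inner_eq_zero hT hn h1 hx)
  exact le_of_mul_le_mul_right this (by positivity)

/-- The other half of Courant–Fischer: the first two eigenvectors span the optimal plane. -/
theorem exists_submodule_second_eigenvalue_le (hT : T.IsSymmetric)
    (hn : Module.finrank ℝ V = n) (h1 : 1 < n) :
    ∃ W : Submodule ℝ V, 2 ≤ Module.finrank ℝ W ∧
      ∀ x ∈ W, hT.eigenvalues hn ⟨1, h1⟩ * ‖x‖ ^ 2 ≤ ⟪x, T x⟫ := by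
  let b := hT.eigenvectorBasis hn
  let f : Fin 2 → Fin n := Fin.castLE h1
  have hli : LinearIndependent ℝ (b ∘ f) :=
    (b.orthonormal.comp f (Fin.castLE_injective _)).linearIndependent
  refine ⟨Submodule.span ℝ (Set.range (b ∘ f)), by simp [finrank_span_eq_card hli], ?_⟩
  intro x hx
  have hzero : ∀ i : Fin n, 1 < i.1 → ⟪b i, x⟫ = 0 := by
    intro i hi
    induction hx using Submodule.span_induction with
    | mem y hy =>
      obtain ⟨j, rfl⟩ := hy
      refine b.orthonormal.2 fun h => ?_
      have : i.1 = j.1 := by rw [h]; rfl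
      omega
    | zero => simp
    | add y z _ _ h h' => rw [inner_add_right, h, h', add_zero]
    | smul a y _ h => rw [real_inner_smul_right, h, mul_zero]
  rw [← sub_nonpos, inner_apply_self_sub hT hn]
  refine Finset.sum_nonpos fun i _ => ?_
  by_cases h : 1 < i.1
  · rw [hzero i h]; simp
  · refine mul_nonpos_of_nonpos_of_nonneg (sub_nonpos.2 (hT.eigenvalues_antitone hn ?_))
      (sq_nonneg _)
    rw [Fin.le_def]
    exact not_lt.1 h

theorem second_eigenvalue_le_add (hT : T.IsSymmetric) (hT' : T'.IsSymmetric)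
    (hn : Module.finrank ℝ V = n) (h1 : 1 < n) {c : ℝ}
    (hc : ∀ x, ⟪x, T x⟫ ≤ ⟪x, T' x⟫ + c * ‖x‖ ^ 2) :
    hT.eigenvalues hn ⟨1, h1⟩ ≤ hT'.eigenvalues hn ⟨1, h1⟩ + c := by
  obtain ⟨W, hW, h⟩ := exists_submodule_second_eigenvalue_le hT hn h1
  rw [← sub_le_iff_le_add]
  refine le_second_eigenvalue hT' hn h1 hW fun x hx => ?_
  linarith [h x hx, hc x]

/-- If a first order perturbation `T - ε S` of `T` keeps a two-dimensional subspace on which the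
form is at least `c`, then `S` is nonpositive at some vector of the hyperplane `u = 0` on which
the form of `T` attains its maximum `c`. -/
theorem exists_inner_apply_self_eq_of_perturbation (T S : V →ₗ[ℝ] V) (u : V) (c δ : ℝ)
    (hδ : 0 < δ) (hle : ∀ x, ⟪u, x⟫ = 0 → ⟪x, T x⟫ ≤ c * ‖x‖ ^ 2)
    (hW : ∀ ε, 0 < ε → ε < δ → ∃ W : Submodule ℝ V, 2 ≤ Module.finrank ℝ W ∧
      ∀ x ∈ W, c * ‖x‖ ^ 2 ≤ ⟪x, T x⟫ - ε * ⟪x, S x⟫) :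
    ∃ x, x ≠ 0 ∧ ⟪u, x⟫ = 0 ∧ ⟪x, T x⟫ = c * ‖x‖ ^ 2 ∧ ⟪x, S x⟫ ≤ 0 := by
  have hTc : Continuous T := T.continuous_of_finiteDimensional
  have hSc : Continuous S := S.continuous_of_finiteDimensional
  let K : Set V := Metric.sphere 0 1 ∩ ({x | ⟪u, x⟫ = 0} ∩ {x | ⟪x, S x⟫ ≤ 0})
  have hK : IsCompact K := (isCompact_sphere (0 : V) 1).inter_right
    ((isClosed_eq (by fun_prop) (by fun_prop)).inter (isClosed_le (by fun_prop) (by fun_prop)))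
  -- On the hyperplane the form of `T` is at most `c`, so a perturbed form that is at least `c`
  -- there forces `⟪x, S x⟫ ≤ 0`.
  have hmem : ∀ ε, 0 < ε → ε < δ → ∃ x ∈ K, c ≤ ⟪x, T x⟫ - ε * ⟪x, S x⟫ := by
    intro ε h0 h1
    obtain ⟨W, hW2, hW⟩ := hW ε h0 h1
    obtain ⟨y, hyW, hy0, hy⟩ := exists_ne_zero_inner_eq_zero hW2 u
    have hny : ‖‖y‖⁻¹ • y‖ = 1 := by
      rw [norm_smul, norm_inv, norm_norm, inv_mul_cancel₀ (norm_ne_zero_iff.2 hy0)]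
    have hux : ⟪u, ‖y‖⁻¹ • y⟫ = 0 := by rw [real_inner_smul_right, hy, mul_zero]
    have h := hW _ (W.smul_mem ‖y‖⁻¹ hyW)
    have h' := hle _ hux
    rw [hny] at h h'
    refine ⟨‖y‖⁻¹ • y, ⟨by simpa using hny, hux, ?_⟩, by linarith⟩
    have : ε * ⟪‖y‖⁻¹ • y, S (‖y‖⁻¹ • y)⟫ ≤ 0 := by linarith
    exact nonpos_of_mul_nonpos_right this h0
  obtain ⟨x₀, hx₀, -⟩ := hmem (δ / 2) (by linarith) (by linarith)
  obtain ⟨x, hx, hmax⟩ := hK.exists_isMaxOn ⟨x₀, hx₀⟩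
    (f := fun x => ⟪x, T x⟫) (by fun_prop)
  obtain ⟨hx1, hux, hSx⟩ := hx
  have hx1' : ‖x‖ = 1 := by simpa using hx1
  refine ⟨x, fun h => by simp [h] at hx1', hux, le_antisymm (hle x hux) ?_, hSx⟩
  -- A lower bound `C` of the form of `S` on `K` shows that the maximum over `K` is at least `c + ε
  -- C` for all small `ε`, hence at least `c`.
  obtain ⟨C, hC⟩ := (hK.image (f := fun x => ⟪x, S x⟫) (by fun_prop)).bddBelow
  rw [hx1', one_pow, mul_one]
  have hlim : Filter.Tendsto (fun ε : ℝ => c + ε * C) (nhdsWithin 0 (Set.Ioi 0)) (nhds c) := by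
    have : Continuous fun ε : ℝ => c + ε * C := by fun_prop
    simpa using (this.tendsto 0).mono_left nhdsWithin_le_nhds
  refine le_of_tendsto hlim ?_
  filter_upwards [Ioo_mem_nhdsGT hδ] with ε hε
  obtain ⟨y, hyK, hy⟩ := hmem ε hε.1 hε.2
  have h1 : ⟪y, T y⟫ ≤ ⟪x, T x⟫ := hmax hyK
  have h2 : ε * C ≤ ε * ⟪y, S y⟫ :=
    mul_le_mul_of_nonneg_left (hC ⟨y, hyK, rfl⟩) hε.1.le
  linarith

/-- A quadratic form taking both signs on a subspace has a nontrivial zero there. -/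
theorem exists_inner_apply_self_eq_zero (S : V →ₗ[ℝ] V) (E : Submodule ℝ V) {x y : V}
    (hx : x ∈ E) (hy : y ∈ E) (hx0 : x ≠ 0) (hy0 : y ≠ 0) (hxS : ⟪x, S x⟫ ≤ 0)
    (hyS : 0 ≤ ⟪y, S y⟫) : ∃ z ∈ E, z ≠ 0 ∧ ⟪z, S z⟫ = 0 := by
  have hSc : Continuous S := S.continuous_of_finiteDimensional
  let p : ℝ → V := fun t => (1 - t) • x + t • y
  have hp : Continuous fun t => ⟪p t, S (p t)⟫ := by fun_prop
  obtain ⟨t, ht, h⟩ := intermediate_value_Icc (zero_le_one (α := ℝ)) hp.continuousOn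
    (show (0 : ℝ) ∈ Set.Icc _ _ by simpa [p] using ⟨hxS, hyS⟩)
  -- If the segment passes through the origin, `x` and `y` are parallel, so the form has the same
  -- sign at both and already vanishes at `x`.
  by_cases hpt : p t = 0
  · refine ⟨x, hx, hx0, ?_⟩
    have hxy : (1 - t) • x = -(t • y) := eq_neg_of_add_eq_zero_left hpt
    have ht1 : 1 - t ≠ 0 := by
      intro h1
      have : t = 1 := by linarith
      rw [this] at hxy
      simp [hy0] at hxy
    have hq : (1 - t) ^ 2 * ⟪x, S x⟫ = t ^ 2 * ⟪y, S y⟫ := by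
      have := congrArg (fun z => ⟪z, S z⟫) hxy
      simp only [map_neg, map_smul, inner_neg_neg, real_inner_smul_left,
        real_inner_smul_right] at this
      linarith
    have : 0 ≤ (1 - t) ^ 2 * ⟪x, S x⟫ := by rw [hq]; positivity
    exact le_antisymm hxS (nonneg_of_mul_nonneg_right this (by positivity))
  · exact ⟨p t, E.add_mem (E.smul_mem _ hx) (E.smul_mem _ hy), hpt, h⟩

end SecondEigenvalue

/-! ### Quadratic forms on a space with complex structure -/

section ComplexStructure

variable {V : Type*} [NormedAddCommGroup V] [InnerProductSpace ℝ V]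

open scoped RealInnerProductSpace

/-- In a space with complex structure `J`, a complex quadratic form (with real part
`⟪x, S x⟫` and imaginary part `-⟪x, S (J x)⟫`) vanishes somewhere on `x + ℂ e`, if it does not
vanish at `e`. -/
theorem exists_isotropic_add (J S : V →ₗ[ℝ] V) (hJJ : ∀ x, J (J x) = -x)
    (hJ : ∀ x y, ⟪J x, y⟫ = -⟪x, J y⟫) (hS : S.IsSymmetric) (hSJ : ∀ x, S (J x) = -J (S x))
    (x e : V) (he : ⟪e, S e⟫ ≠ 0 ∨ ⟪e, S (J e)⟫ ≠ 0) :
    ∃ p q : ℝ, ⟪x + p • e + q • J e, S (x + p • e + q • J e)⟫ = 0 ∧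
      ⟪x + p • e + q • J e, S (J (x + p • e + q • J e))⟫ = 0 := by
  -- At `x + z e`, with `z = p + i q` acting through `J`, the complex form equals `a z² + b z + c`.
  let a : ℂ := ⟨⟪e, S e⟫, -⟪e, S (J e)⟫⟩
  let b : ℂ := ⟨2 * ⟪x, S e⟫, -(2 * ⟪x, S (J e)⟫)⟩
  let c : ℂ := ⟨⟪x, S x⟫, -⟪x, S (J x)⟫⟩
  have ha : a ≠ 0 := by
    intro h
    have h1 := congrArg Complex.re h
    have h2 := congrArg Complex.im h
    simp only [a, Complex.zero_re, Complex.zero_im, neg_eq_zero] at h1 h2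
    tauto
  obtain ⟨s, hs⟩ := IsAlgClosed.exists_pow_nat_eq (discrim a b c) (n := 2) (by norm_num)
  obtain ⟨z, hz⟩ := exists_quadratic_eq_zero ha ⟨s, by rw [← hs, sq]⟩
  have h1 := congrArg Complex.re hz
  have h2 := congrArg Complex.im hz
  simp only [a, b, c, Complex.add_re, Complex.mul_re, Complex.add_im, Complex.mul_im,
    Complex.zero_re, Complex.zero_im] at h1 h2
  have e1 : ∀ y z, ⟪J y, S z⟫ = ⟪y, S (J z)⟫ := fun y z => by rw [hJ, hSJ, inner_neg_right]
  have e2 : ∀ y z, ⟪y, S z⟫ = ⟪z, S y⟫ := fun y z => by rw [← hS, real_inner_comm]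
  have e3 : ∀ y z, ⟪y, S (J z)⟫ = ⟪z, S (J y)⟫ := fun y z => by rw [← e1, e2]
  refine ⟨z.re, z.im, ?_, ?_⟩
  · simp only [map_add, map_smul, inner_add_left, inner_add_right, real_inner_smul_left,
      real_inner_smul_right, e1, hJJ, map_neg, inner_neg_right, e2 e x, e3 e x]
    linarith
  · simp only [map_add, map_smul, inner_add_left, inner_add_right, real_inner_smul_left,
      real_inner_smul_right, e1, hJJ, map_neg, inner_neg_right, e2 e x, e3 e x]
    linarith

/-- Rotating by the complex structure `J` makes a complex quadratic form real and nonnegative. -/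
theorem exists_rotation (J S : V →ₗ[ℝ] V) (hJJ : ∀ x, J (J x) = -x)
    (hJ : ∀ x y, ⟪J x, y⟫ = -⟪x, J y⟫) (hSJ : ∀ x, S (J x) = -J (S x)) (x : V) (hx : x ≠ 0) :
    ∃ p q : ℝ, p • x + q • J x ≠ 0 ∧ 0 ≤ ⟪p • x + q • J x, S (p • x + q • J x)⟫ ∧
      ⟪p • x + q • J x, S (J (p • x + q • J x))⟫ = 0 := by
  let a : ℂ := ⟨⟪x, S x⟫, -⟪x, S (J x)⟫⟩
  have e1 : ∀ y z, ⟪J y, S z⟫ = ⟪y, S (J z)⟫ := fun y z => by rw [hJ, hSJ, inner_neg_right]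
  have hskew : ⟪x, J x⟫ = 0 := by
    have := hJ x x
    rw [real_inner_comm] at this
    linarith
  by_cases ha : a = 0
  · have h1 := congrArg Complex.re ha
    have h2 := congrArg Complex.im ha
    simp only [a, Complex.zero_re, Complex.zero_im, neg_eq_zero] at h1 h2
    exact ⟨1, 0, by simpa using hx, by simp [h1], by simp [h2]⟩
  -- Multiplying the vector by `z` multiplies the form by `z²`, and `z² a = |a|²` is real and
  -- nonnegative.
  obtain ⟨z, hz⟩ := IsAlgClosed.exists_pow_nat_eq ((starRingEnd ℂ) a) (n := 2) (by norm_num)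
  have hz0 : z ≠ 0 := by
    rintro rfl
    rw [zero_pow two_ne_zero, eq_comm, map_eq_zero] at hz
    exact ha hz
  have hza : z ^ 2 * a = (Complex.normSq a : ℂ) := by rw [hz, Complex.normSq_eq_conj_mul_self]
  have h1 := congrArg Complex.re hza
  have h2 := congrArg Complex.im hza
  have h3 := Complex.normSq_nonneg a
  rw [Complex.ofReal_re] at h1
  rw [Complex.ofReal_im] at h2
  simp only [a, sq, Complex.mul_re, Complex.mul_im] at h1 h2
  refine ⟨z.re, z.im, fun h => ?_, ?_, ?_⟩
  · have hn : (z.re ^ 2 + z.im ^ 2) * ⟪x, x⟫ = 0 := by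
      have h4 := congrArg (fun y => ⟪y, x⟫) h
      have h5 := congrArg (fun y => ⟪y, J x⟫) h
      simp only [inner_add_left, real_inner_smul_left, inner_zero_left, hskew, hJ, hJJ,
        inner_neg_right] at h4 h5
      linear_combination z.re * h4 + z.im * h5
    rcases mul_eq_zero.1 hn with h4 | h4
    · exact hz0 (Complex.ext (by simp; nlinarith) (by simp; nlinarith))
    · exact hx (inner_self_eq_zero.1 h4)
  · simp only [map_add, map_smul, inner_add_left, inner_add_right, real_inner_smul_left,
      real_inner_smul_right, e1, hJJ, map_neg, inner_neg_right]
    linarith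
  · simp only [map_add, map_smul, inner_add_left, inner_add_right, real_inner_smul_left,
      real_inner_smul_right, e1, hJJ, map_neg, inner_neg_right]
    linarith

theorem two_le_finrank_span_pair {x y : V} (hx : x ≠ 0) (hy : y ≠ 0) (h : ⟪x, y⟫ = 0) :
    2 ≤ Module.finrank ℝ (Submodule.span ℝ {x, y}) := by
  have hli : LinearIndependent ℝ ![x, y] := by
    rw [LinearIndependent.pair_iff]
    intro s t hst
    have h1 := congrArg (fun z => ⟪x, z⟫) hst
    have h2 := congrArg (fun z => ⟪y, z⟫) hst
    simp only [inner_add_right, real_inner_smul_right, inner_zero_right, h,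
      real_inner_comm x y, mul_zero, add_zero, zero_add, mul_eq_zero, inner_self_eq_zero,
      hx, hy, or_false] at h1 h2
    exact ⟨h1, h2⟩
  have := finrank_span_eq_card hli
  rw [Matrix.range_cons, Matrix.range_cons, Matrix.range_empty, Set.union_empty,
    Set.singleton_union] at this
  simp [this]

variable [FiniteDimensional ℝ V]

/-- Let `A` be symmetric and `J`-linear, `S` symmetric and `J`-antilinear. If every form
`A - t S`, `0 ≤ t < 1`, is nonnegative on a subspace of dimension two, then there is a vector at
which the `J`-invariant form of `A` dominates the modulus of the complex form of `S`. -/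
theorem exists_abs_inner_le_inner (J A S : V →ₗ[ℝ] V) (hJJ : ∀ x, J (J x) = -x)
    (hJ : ∀ x y, ⟪J x, y⟫ = -⟪x, J y⟫) (hA : A.IsSymmetric) (hS : S.IsSymmetric)
    (hAJ : ∀ x, A (J x) = J (A x)) (hSJ : ∀ x, S (J x) = -J (S x))
    (hW : ∀ t : ℝ, 0 ≤ t → t < 1 → ∃ W : Submodule ℝ V, 2 ≤ Module.finrank ℝ W ∧
      ∀ x ∈ W, 0 ≤ ⟪x, A x⟫ - t * ⟪x, S x⟫) :
    ∃ x, x ≠ 0 ∧ ⟪x, S (J x)⟫ = 0 ∧ |⟪x, S x⟫| ≤ ⟪x, A x⟫ := by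
  have hsym : ∀ t : ℝ, (A - t • S).IsSymmetric := fun t => hA.sub (hS.smul (by simp))
  obtain ⟨n, hn⟩ : ∃ n, Module.finrank ℝ V = n := ⟨_, rfl⟩
  have h1 : 1 < n := by
    obtain ⟨W, hW2, -⟩ := hW 0 le_rfl one_pos
    have := Submodule.finrank_le W
    omega
  have happ : ∀ (t : ℝ) x, ⟪x, (A - t • S) x⟫ = ⟪x, A x⟫ - t * ⟪x, S x⟫ := fun t x => by
    simp [inner_sub_right, real_inner_smul_right]
  have hskew : ∀ x, ⟪x, J x⟫ = 0 := fun x => by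
    have := hJ x x
    rw [real_inner_comm] at this
    linarith
  have hAskew : ∀ x, ⟪J x, A x⟫ = 0 := fun x => by
    have h2 := hJ x (A x)
    rw [← hAJ, ← hA, real_inner_comm] at h2
    linarith [real_inner_comm (A x) (J x), hA x (J x)]
  let l : ℝ → ℝ := fun t => (hsym t).eigenvalues hn ⟨1, h1⟩
  obtain ⟨C, hC0, hC⟩ : ∃ C : ℝ, 0 ≤ C ∧ ∀ x, |⟪x, S x⟫| ≤ C * ‖x‖ ^ 2 := by
    refine ⟨‖S.toContinuousLinearMap‖, norm_nonneg _, fun x => ?_⟩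
    refine (abs_real_inner_le_norm _ _).trans ?_
    have := S.toContinuousLinearMap.le_opNorm x
    rw [LinearMap.coe_toContinuousLinearMap'] at this
    nlinarith [norm_nonneg x]
  have hlip : ∀ t u, l t ≤ l u + C * |t - u| := by
    intro t u
    refine second_eigenvalue_le_add (hsym t) (hsym u) hn h1 fun x => ?_
    rw [happ, happ]
    have h2 : |(u - t) * ⟪x, S x⟫| ≤ |t - u| * (C * ‖x‖ ^ 2) := by
      rw [abs_mul, abs_sub_comm]
      exact mul_le_mul_of_nonneg_left (hC x) (abs_nonneg _)
    linarith [le_abs_self ((u - t) * ⟪x, S x⟫)]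
  have hcont : Continuous l := by
    have : LipschitzWith ⟨C, hC0⟩ l := LipschitzWith.of_le_add_mul _ fun t u => by
      rw [Real.dist_eq]; exact hlip t u
    exact this.continuous
  have hnonneg : ∀ t ∈ Set.Icc (0 : ℝ) 1, 0 ≤ l t := by
    have hIco : ∀ t ∈ Set.Ico (0 : ℝ) 1, l t ∈ Set.Ici (0 : ℝ) := by
      intro t ht
      obtain ⟨W, hW2, hW⟩ := hW t ht.1 ht.2
      refine le_second_eigenvalue (hsym t) hn h1 hW2 fun x hx => ?_
      rw [happ, zero_mul]
      exact hW x hx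
    intro t ht
    -- The hypothesis omits `t = 1`, which is reached by continuity.
    rw [← closure_Ico (zero_ne_one (α := ℝ))] at ht
    exact (isClosed_Ici.preimage hcont).closure_subset_iff.2 hIco ht
  obtain ⟨t, ht, hmin⟩ := isCompact_Icc.exists_isMinOn (Set.nonempty_Icc.2 (zero_le_one (α := ℝ)))
    hcont.continuousOn
  have hl := hnonneg t ht
  let E : Submodule ℝ V := LinearMap.ker (A - t • S - l t • LinearMap.id)
  have hE : ∀ x, x ∈ E ↔ A x = l t • x + t • S x := fun x => by
    rw [LinearMap.mem_ker, LinearMap.sub_apply, sub_eq_zero, LinearMap.sub_apply, sub_eq_iff_eq_add]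
    simp
  have hpert : ∀ u, u ∈ Set.Icc (0 : ℝ) 1 → ∃ W : Submodule ℝ V, 2 ≤ Module.finrank ℝ W ∧
      ∀ x ∈ W, l t * ‖x‖ ^ 2 ≤ ⟪x, A x⟫ - u * ⟪x, S x⟫ := by
    intro u hu
    obtain ⟨W, hW2, hW⟩ := exists_submodule_second_eigenvalue_le (hsym u) hn h1
    refine ⟨W, hW2, fun x hx => ?_⟩
    rw [← happ]
    exact (mul_le_mul_of_nonneg_right (hmin hu) (sq_nonneg _)).trans (hW x hx)
  -- Increasing `t` cannot lower the second eigenvalue below its minimum; this one-sided condition,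
  -- like its mirror image for `0 < t`, fixes the sign of `S` somewhere on the eigenspace `E`.
  have hright : t < 1 → ∃ x ∈ E, x ≠ 0 ∧ ⟪x, S x⟫ ≤ 0 := by
    intro ht1
    obtain ⟨x, hx0, hux, hx, hSx⟩ := exists_inner_apply_self_eq_of_perturbation (A - t • S) S
      ((hsym t).eigenvectorBasis hn ⟨0, by omega⟩) (l t) (1 - t) (by linarith)
      (fun x hx => inner_apply_self_le_of_inner_eq_zero (hsym t) hn h1 hx) fun ε h0 h1 => by
        obtain ⟨W, hW2, hW⟩ := hpert (t + ε) ⟨by linarith [ht.1], by linarith⟩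
        refine ⟨W, hW2, fun x hx => ?_⟩
        rw [happ]
        linarith [hW x hx]
    refine ⟨x, (hE x).2 ?_, hx0, hSx⟩
    rw [← sub_eq_iff_eq_add]
    exact apply_eq_smul_of_inner_apply_self_eq (hsym t) hn
      (inner_eq_zero_or_eigenvalue_le (hsym t) hn h1 hux) hx
  have hleft : 0 < t → ∃ x ∈ E, x ≠ 0 ∧ 0 ≤ ⟪x, S x⟫ := by
    intro ht0
    obtain ⟨x, hx0, hux, hx, hSx⟩ := exists_inner_apply_self_eq_of_perturbation (A - t • S) (-S)
      ((hsym t).eigenvectorBasis hn ⟨0, by omega⟩) (l t) t ht0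
      (fun x hx => inner_apply_self_le_of_inner_eq_zero (hsym t) hn h1 hx) fun ε h0 h1 => by
        obtain ⟨W, hW2, hW⟩ := hpert (t - ε) ⟨by linarith, by linarith [ht.2]⟩
        refine ⟨W, hW2, fun x hx => ?_⟩
        rw [happ, LinearMap.neg_apply, inner_neg_right]
        linarith [hW x hx]
    refine ⟨x, (hE x).2 ?_, hx0, by simpa using hSx⟩
    rw [← sub_eq_iff_eq_add]
    exact apply_eq_smul_of_inner_apply_self_eq (hsym t) hn
      (inner_eq_zero_or_eigenvalue_le (hsym t) hn h1 hux) hx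
  have hEinner : ∀ x ∈ E, ⟪x, A x⟫ = l t * ‖x‖ ^ 2 + t * ⟪x, S x⟫ := by
    intro x hx
    rw [(hE x).1 hx, inner_add_right, real_inner_smul_right, real_inner_smul_right,
      real_inner_self_eq_norm_sq]
  -- `J x` is orthogonal to both `x` and `A x`, hence to `t S x`.
  have hEskew : 0 < t → ∀ x ∈ E, ⟪x, S (J x)⟫ = 0 := by
    intro ht0 x hx
    have h2 := hAskew x
    rw [(hE x).1 hx, inner_add_right, real_inner_smul_right, real_inner_smul_right,
      real_inner_comm, hskew, mul_zero, zero_add] at h2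
    rw [hSJ, inner_neg_right, ← hJ]
    exact (mul_eq_zero.1 h2).resolve_left ht0.ne'
  rcases ht.1.eq_or_lt with ht0 | ht0
  · -- the minimum is attained at the `J`-invariant form
    subst ht0
    simp only [zero_smul, add_zero, zero_mul] at hE hEinner
    have hEJ : ∀ x ∈ E, J x ∈ E := fun x hx => by
      rw [hE, hAJ, (hE x).1 hx, map_smul]
    -- `A` commutes with `J`, so `J b` accompanies the top eigenvector `b`: the top eigenvalue is at
    -- least double and equals the second.
    have hmax : ∀ i, (hsym 0).eigenvalues hn i ≤ l 0 := by
      let b := (hsym 0).eigenvectorBasis hn ⟨0, by omega⟩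
      let m := (hsym 0).eigenvalues hn ⟨0, by omega⟩
      have hb : A b = m • b := by
        have h2 : (A - (0 : ℝ) • S) b = m • b :=
          (hsym 0).apply_eigenvectorBasis hn ⟨0, by omega⟩
        simpa only [zero_smul, sub_zero] using h2
      have hb0 : b ≠ 0 := ((hsym 0).eigenvectorBasis hn).orthonormal.ne_zero _
      have hJb0 : J b ≠ 0 := fun h => hb0 (by
        have := hJJ b
        rwa [h, map_zero, eq_comm, neg_eq_zero] at this)
      have hm : m ≤ l 0 := by
        refine le_second_eigenvalue (hsym 0) hn h1
          (two_le_finrank_span_pair hb0 hJb0 (hskew b)) fun x hx => ?_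
        have hAx : A x = m • x := by
          obtain ⟨p, q, rfl⟩ := Submodule.mem_span_pair.1 hx
          simp only [map_add, map_smul, hAJ, hb, smul_add, smul_comm m]
        rw [happ, hAx, real_inner_smul_right, real_inner_self_eq_norm_sq]
        simp
      exact fun i => ((hsym 0).eigenvalues_antitone hn
        (Fin.mk_le_of_le_val (Nat.zero_le _))).trans hm
    have htop : ∀ x, ⟪x, A x⟫ ≤ l 0 * ‖x‖ ^ 2 := fun x => by
      have h2 := inner_apply_self_sub (hsym 0) hn x (l 0)
      rw [happ, zero_mul, sub_zero] at h2
      rw [← sub_nonneg, h2]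
      exact Finset.sum_nonneg fun i _ => mul_nonneg (sub_nonneg.2 (hmax i)) (sq_nonneg _)
    have hEtop : ∀ x, ⟪x, A x⟫ = l 0 * ‖x‖ ^ 2 → x ∈ E := fun x hx => by
      rw [hE]
      simpa only [zero_smul, sub_zero] using apply_eq_smul_of_inner_apply_self_eq (hsym 0) hn
        (fun i => Or.inr (hmax i)) (by rwa [happ, zero_mul, sub_zero])
    obtain ⟨y, hyE, hy0, -⟩ := hright one_pos
    obtain ⟨p, q, he0, heS, heSJ⟩ := exists_rotation J S hJJ hJ hSJ y hy0
    set e := p • y + q • J y with he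
    have heE : e ∈ E := E.add_mem (E.smul_mem _ hyE) (E.smul_mem _ (hEJ y hyE))
    have hfin : ∀ z ∈ E, z ≠ 0 → ⟪z, S z⟫ = 0 → ⟪z, S (J z)⟫ = 0 →
        ∃ x, x ≠ 0 ∧ ⟪x, S (J x)⟫ = 0 ∧ |⟪x, S x⟫| ≤ ⟪x, A x⟫ := by
      intro z hz hz0 h2 h3
      refine ⟨z, hz0, h3, ?_⟩
      rw [h2, abs_zero, hEinner z hz]
      positivity
    rcases heS.eq_or_lt with heS | heS
    · exact hfin e heE he0 heS.symm heSJ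
    -- Since `l 0` bounds the form everywhere, the hyperplane may be chosen freely. Orthogonality to
    -- `J e` and `⟪x, S x⟫ ≤ 0 < ⟪e, S e⟫` keep `x` out of `ℂ e`, so the isotropic vector in `x + ℂ
    -- e` is nonzero.
    obtain ⟨x, hx0, hux, hx, hSx⟩ := exists_inner_apply_self_eq_of_perturbation A S
      (J e) (l 0) 1 one_pos (fun x _ => htop x) fun ε h0 h1 => hpert ε ⟨h0.le, h1.le⟩
    obtain ⟨p', q', h2, h3⟩ := exists_isotropic_add J S hJJ hJ hS hSJ x e (Or.inl heS.ne')
    refine hfin _ (E.add_mem (E.add_mem (hEtop x hx) (E.smul_mem _ heE))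
      (E.smul_mem _ (hEJ e heE))) (fun h => ?_) h2 h3
    have h4 := congrArg (fun z => ⟪J e, z⟫) h
    simp only [inner_add_right, hux, real_inner_smul_right, inner_zero_right, zero_add] at h4
    rw [real_inner_comm, hskew, mul_zero, zero_add] at h4
    have hJe0 : J e ≠ 0 := fun h => he0 (by
      have := hJJ e
      rwa [h, map_zero, eq_comm, neg_eq_zero] at this)
    have hq : q' = 0 := (mul_eq_zero.1 h4).resolve_right fun h => hJe0 (inner_self_eq_zero.1 h)
    rw [hq, zero_smul, add_zero] at h
    have hxe : x = -(p' • e) := eq_neg_of_add_eq_zero_left h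
    rw [hxe, map_neg, inner_neg_neg, map_smul, real_inner_smul_left, real_inner_smul_right] at hSx
    have hp : p' = 0 := by
      by_contra hp
      have : 0 < p' * (p' * ⟪e, S e⟫) := by
        rw [← mul_assoc]; exact mul_pos (mul_self_pos.2 hp) heS
      linarith
    exact hx0 (by rw [hxe, hp, zero_smul, neg_zero])
  · obtain ⟨y, hyE, hy0, hyS⟩ := hleft ht0
    rcases ht.2.eq_or_lt with ht1 | ht1
    · refine ⟨y, hy0, hEskew ht0 y hyE, ?_⟩
      rw [abs_of_nonneg hyS, hEinner y hyE, ht1, one_mul, ← ht1]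
      exact le_add_of_nonneg_left (by positivity)
    · obtain ⟨x, hxE, hx0, hxS⟩ := hright ht1
      obtain ⟨z, hzE, hz0, hzS⟩ := exists_inner_apply_self_eq_zero S E hxE hyE hx0 hy0 hxS hyS
      refine ⟨z, hz0, hEskew ht0 z hzE, ?_⟩
      rw [hEinner z hzE, hzS]
      simp only [abs_zero, mul_zero, add_zero]
      positivity

end ComplexStructure

/-! ### Courant–Fischer for the second singular value -/

section SingularValue

open scoped RealInnerProductSpace

variable {ι κ : Type*} [Fintype ι] [Fintype κ] [DecidableEq κ]

theorem exists_submodule_of_le_secondSingularValue (A : Matrix ι κ ℝ) {c : ℝ} (hc : 0 < c)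
    (h : c ≤ secondSingularValue A) :
    ∃ W : Submodule ℝ (EuclideanSpace ℝ κ), 2 ≤ Module.finrank ℝ W ∧
      ∀ x ∈ W, c ^ 2 * ‖x‖ ^ 2 ≤ ‖Matrix.toEuclideanLin A x‖ ^ 2 := by
  set T := Matrix.toEuclideanLin A
  have h1 : 1 < Module.finrank ℝ (EuclideanSpace ℝ κ) := by
    -- In dimension below two the second singular value is `0` by default, which `0 < c` excludes.
    by_contra h'
    have : secondSingularValue A = 0 := T.singularValues_of_finrank_le (not_lt.1 h')
    linarith
  obtain ⟨W, hW2, hW⟩ := exists_submodule_second_eigenvalue_le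
    T.isSymmetric_adjoint_comp_self rfl h1
  rw [← T.sq_singularValues_of_lt rfl h1] at hW
  refine ⟨W, hW2, fun x hx => ?_⟩
  have h2 := hW x hx
  rw [LinearMap.comp_apply, LinearMap.adjoint_inner_right, real_inner_self_eq_norm_sq] at h2
  refine le_trans ?_ h2
  have h3 : c ≤ T.singularValues 1 := h
  gcongr

theorem le_secondSingularValue (A : Matrix ι κ ℝ) {c : ℝ}
    {W : Submodule ℝ (EuclideanSpace ℝ κ)} (hW2 : 2 ≤ Module.finrank ℝ W)
    (hW : ∀ x ∈ W, c ^ 2 * ‖x‖ ^ 2 ≤ ‖Matrix.toEuclideanLin A x‖ ^ 2) :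
    c ≤ secondSingularValue A := by
  set T := Matrix.toEuclideanLin A
  have h1 : 1 < Module.finrank ℝ (EuclideanSpace ℝ κ) := by
    have := Submodule.finrank_le W
    omega
  have h2 := le_second_eigenvalue T.isSymmetric_adjoint_comp_self rfl h1 hW2 (c := c ^ 2)
    fun x hx => by
      rw [LinearMap.comp_apply, LinearMap.adjoint_inner_right, real_inner_self_eq_norm_sq]
      exact hW x hx
  rw [← T.sq_singularValues_of_lt rfl h1] at h2
  exact le_of_sq_le_sq h2 (T.singularValues_nonneg 1)

end SingularValue

/-! ### Matrix norms and interpolation by matrices of rank at most two -/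

section Norms

open scoped RealInnerProductSpace

theorem norm_toEuclideanLin_le {m p : ℕ} (D : Matrix (Fin m) (Fin p) ℝ)
    (x : EuclideanSpace ℝ (Fin p)) :
    ‖Matrix.toEuclideanLin D x‖ ≤ matrixSpectralNorm D * ‖x‖ :=
  (Matrix.toEuclideanLin.trans LinearMap.toContinuousLinearMap D).le_opNorm x

theorem matrixSpectralNorm_le {m p : ℕ} (D : Matrix (Fin m) (Fin p) ℝ) {c : ℝ} (hc : 0 ≤ c)
    (h : ∀ x, ‖Matrix.toEuclideanLin D x‖ ≤ c * ‖x‖) : matrixSpectralNorm D ≤ c :=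
  (Matrix.toEuclideanLin.trans LinearMap.toContinuousLinearMap D).opNorm_le_bound hc h

theorem matrixSpectralNorm_nonneg {m p : ℕ} (D : Matrix (Fin m) (Fin p) ℝ) :
    0 ≤ matrixSpectralNorm D :=
  norm_nonneg (Matrix.toEuclideanLin.trans LinearMap.toContinuousLinearMap D)

theorem frobeniusNorm_sq {m p : ℕ} (D : Matrix (Fin m) (Fin p) ℝ) :
    frobeniusNorm D ^ 2 = ∑ i, ∑ j, D i j ^ 2 := by
  rw [frobeniusNorm, Matrix.frobenius_norm_def, ← Real.sqrt_eq_rpow, Real.sq_sqrt (by positivity)]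
  simp

theorem frobeniusNorm_nonneg {m p : ℕ} (D : Matrix (Fin m) (Fin p) ℝ) : 0 ≤ frobeniusNorm D :=
  @norm_nonneg _ Matrix.frobeniusSeminormedAddCommGroup.toSeminormedAddGroup D

theorem frobeniusNorm_sq_eq_sum_norm {m p : ℕ} (D : Matrix (Fin m) (Fin p) ℝ) :
    frobeniusNorm D ^ 2 =
      ∑ j, ‖Matrix.toEuclideanLin D (EuclideanSpace.basisFun (Fin p) ℝ j)‖ ^ 2 := by
  rw [frobeniusNorm_sq, Finset.sum_comm]
  refine Finset.sum_congr rfl fun j _ => ?_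
  rw [EuclideanSpace.real_norm_sq_eq]
  refine Finset.sum_congr rfl fun i _ => ?_
  simp [Matrix.toLpLin_apply]

theorem matrixSpectralNorm_le_frobeniusNorm {m p : ℕ} (D : Matrix (Fin m) (Fin p) ℝ) :
    matrixSpectralNorm D ≤ frobeniusNorm D := by
  refine matrixSpectralNorm_le D (frobeniusNorm_nonneg D) fun x => ?_
  refine le_of_sq_le_sq ?_ (mul_nonneg (frobeniusNorm_nonneg D) (norm_nonneg x))
  rw [mul_pow, frobeniusNorm_sq, EuclideanSpace.real_norm_sq_eq, EuclideanSpace.real_norm_sq_eq,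
    Finset.sum_mul]
  refine Finset.sum_le_sum fun i _ => ?_
  exact Finset.sum_mul_sq_le_sq_mul_sq Finset.univ (D i) x

theorem frobeniusNorm_sub_sq_le {m p : ℕ} (D D' : Matrix (Fin m) (Fin p) ℝ) :
    frobeniusNorm (D - D') ^ 2 ≤ 2 * (frobeniusNorm D ^ 2 + frobeniusNorm D' ^ 2) := by
  simp only [frobeniusNorm_sq, ← Finset.sum_add_distrib, Finset.mul_sum]
  refine Finset.sum_le_sum fun i _ => Finset.sum_le_sum fun j _ => ?_
  rw [Matrix.sub_apply]
  nlinarith [sq_nonneg (D i j + D' i j)]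

/-- A contraction condition on pairs of real vectors yields a real matrix of rank at most two
mapping one pair to the other. -/
theorem exists_matrix_of_norm_le {m p : ℕ} (a b : EuclideanSpace ℝ (Fin m))
    (c d : EuclideanSpace ℝ (Fin p)) {δ : ℝ} (hδ : 0 ≤ δ)
    (h : ∀ s t : ℝ, ‖s • a + t • b‖ ≤ δ * ‖s • c + t • d‖) :
    ∃ D : Matrix (Fin m) (Fin p) ℝ, Matrix.toEuclideanLin D c = a ∧
      Matrix.toEuclideanLin D d = b ∧ matrixSpectralNorm D ≤ δ ∧
      frobeniusNorm D ^ 2 ≤ 2 * δ ^ 2 := by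
  let K : ℝ × ℝ →ₗ[ℝ] EuclideanSpace ℝ (Fin m) :=
    (LinearMap.toSpanSingleton ℝ _ a).coprod (LinearMap.toSpanSingleton ℝ _ b)
  let L : ℝ × ℝ →ₗ[ℝ] EuclideanSpace ℝ (Fin p) :=
    (LinearMap.toSpanSingleton ℝ _ c).coprod (LinearMap.toSpanSingleton ℝ _ d)
  have hKL : ∀ v, ‖K v‖ ≤ δ * ‖L v‖ := fun v => by simpa [K, L] using h v.1 v.2
  let W := LinearMap.range L
  obtain ⟨r, hr⟩ := L.rangeRestrict.exists_rightInverse_of_surjective L.range_rangeRestrict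
  have hr' : ∀ y : W, L (r y) = y := fun y =>
    congrArg Subtype.val (LinearMap.congr_fun hr y)
  let g : EuclideanSpace ℝ (Fin p) →ₗ[ℝ] EuclideanSpace ℝ (Fin m) :=
    K ∘ₗ r ∘ₗ W.orthogonalProjectionOnto.toLinearMap
  -- The choice of preimage is harmless: the bound `hKL` makes `K` vanish on the kernel of `L`.
  have hgL : ∀ v, g (L v) = K v := by
    intro v
    have h1 : W.orthogonalProjectionOnto (L v) = ⟨L v, LinearMap.mem_range_self L v⟩ :=
      Submodule.orthogonalProjectionOnto_mem_subspace_eq_self (K := W)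
        ⟨L v, LinearMap.mem_range_self L v⟩
    have h2 : g (L v) = K (r ⟨L v, LinearMap.mem_range_self L v⟩) := by
      rw [← h1]; rfl
    rw [h2, ← sub_eq_zero, ← map_sub, ← norm_le_zero_iff]
    refine (hKL _).trans_eq ?_
    rw [map_sub, hr', sub_self, norm_zero, mul_zero]
  have hg : ∀ y, ‖g y‖ ≤ δ * ‖W.starProjection y‖ := by
    intro y
    have h1 := hKL (r (W.orthogonalProjectionOnto y))
    rw [hr'] at h1
    exact h1
  refine ⟨Matrix.toEuclideanLin.symm g, ?_, ?_, ?_, ?_⟩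
  · simpa [K, L] using hgL (1, 0)
  · simpa [K, L] using hgL (0, 1)
  · refine matrixSpectralNorm_le _ hδ fun x => ?_
    rw [LinearEquiv.apply_symm_apply]
    exact (hg x).trans (mul_le_mul_of_nonneg_left (W.norm_starProjection_apply_le x) hδ)
  · rw [frobeniusNorm_sq_eq_sum_norm, LinearEquiv.apply_symm_apply]
    -- The squared Frobenius norm of an orthogonal projection is its trace, that is its rank, here
    -- at most `2`.
    have hproj : LinearMap.IsProj W W.starProjection.toLinearMap :=
      ⟨fun x => W.starProjection_apply_mem x, fun x hx => W.starProjection_eq_self_iff.2 hx⟩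
    have htr := hproj.trace
    rw [LinearMap.trace_eq_sum_inner _ (EuclideanSpace.basisFun (Fin p) ℝ)] at htr
    have hdim : (Module.finrank ℝ W : ℝ) ≤ 2 := by
      have := L.finrank_range_le
      rw [Module.finrank_prod, Module.finrank_self] at this
      exact_mod_cast this
    calc ∑ j, ‖g (EuclideanSpace.basisFun (Fin p) ℝ j)‖ ^ 2
        ≤ ∑ j, δ ^ 2 * ⟪EuclideanSpace.basisFun (Fin p) ℝ j,
            W.starProjection (EuclideanSpace.basisFun (Fin p) ℝ j)⟫ := by
          refine Finset.sum_le_sum fun j _ => ?_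
          have h1 : ∀ y, ⟪y, W.starProjection y⟫ = ‖W.starProjection y‖ ^ 2 := fun y => by
            rw [← real_inner_self_eq_norm_sq, Submodule.inner_starProjection_left_eq_right,
              W.starProjection_eq_self_iff.2 (W.starProjection_apply_mem y)]
          rw [h1, ← mul_pow]
          have := hg (EuclideanSpace.basisFun (Fin p) ℝ j)
          gcongr
      _ = δ ^ 2 * Module.finrank ℝ W := by rw [← Finset.mul_sum, ← htr]; rfl
      _ ≤ 2 * δ ^ 2 := by nlinarith [sq_nonneg δ]

end Norms

/-! ### Forms pulled back along a complex-linear map -/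

section Abstract

open scoped RealInnerProductSpace

variable {V V' : Type*} [NormedAddCommGroup V] [InnerProductSpace ℝ V] [FiniteDimensional ℝ V]
  [NormedAddCommGroup V'] [InnerProductSpace ℝ V'] [FiniteDimensional ℝ V']

/-- The version of `exists_abs_inner_le_inner` for the forms induced by a `J`-linear map `P`. -/
theorem exists_abs_le_norm_sq_sub (J K : V →ₗ[ℝ] V) (J' K' : V' →ₗ[ℝ] V') (P : V →ₗ[ℝ] V')
    (hJJ : ∀ x, J (J x) = -x) (hJ : ∀ x y, ⟪J x, y⟫ = -⟪x, J y⟫)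
    (hJ' : ∀ x y, ⟪J' x, y⟫ = -⟪x, J' y⟫) (hK : K.IsSymmetric) (hK' : K'.IsSymmetric)
    (hKJ : ∀ x, K (J x) = -J (K x)) (hKJ' : ∀ x, K' (J' x) = -J' (K' x))
    (hP : ∀ x, P (J x) = J' (P x)) (c : ℝ)
    (hW : ∀ t : ℝ, 0 ≤ t → t < 1 → ∃ W : Submodule ℝ V, 2 ≤ Module.finrank ℝ W ∧
      ∀ x ∈ W, 0 ≤ ‖P x‖ ^ 2 - c * ‖x‖ ^ 2 - t * (⟪P x, K' (P x)⟫ - c * ⟪x, K x⟫)) :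
    ∃ x, x ≠ 0 ∧ ⟪P x, K' (J' (P x))⟫ = c * ⟪x, K (J x)⟫ ∧
      |⟪P x, K' (P x)⟫ - c * ⟪x, K x⟫| ≤ ‖P x‖ ^ 2 - c * ‖x‖ ^ 2 := by
  let A : V →ₗ[ℝ] V := LinearMap.adjoint P ∘ₗ P - c • LinearMap.id
  let S : V →ₗ[ℝ] V := LinearMap.adjoint P ∘ₗ K' ∘ₗ P - c • K
  have hAr : ∀ x y, ⟪x, A y⟫ = ⟪P x, P y⟫ - c * ⟪x, y⟫ := fun x y => by
    simp [A, inner_sub_right, real_inner_smul_right, LinearMap.adjoint_inner_right]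
  have hAl : ∀ x y, ⟪A x, y⟫ = ⟪P x, P y⟫ - c * ⟪x, y⟫ := fun x y => by
    simp [A, inner_sub_left, real_inner_smul_left, LinearMap.adjoint_inner_left]
  have hSr : ∀ x y, ⟪x, S y⟫ = ⟪P x, K' (P y)⟫ - c * ⟪x, K y⟫ := fun x y => by
    simp [S, inner_sub_right, real_inner_smul_right, LinearMap.adjoint_inner_right]
  have hSl : ∀ x y, ⟪S x, y⟫ = ⟪P x, K' (P y)⟫ - c * ⟪x, K y⟫ := fun x y => by
    rw [← hK', ← hK]
    simp [S, inner_sub_left, real_inner_smul_left, LinearMap.adjoint_inner_left]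
  obtain ⟨x, hx0, h1, h2⟩ := exists_abs_inner_le_inner J A S hJJ hJ
    (fun x y => by rw [hAr, hAl]) (fun x y => by rw [hSr, hSl])
    (fun x => ext_inner_right ℝ fun y => by rw [hAl, hJ x, hJ, hAl, hP, hP, hJ']; ring)
    (fun x => ext_inner_right ℝ fun y => by
      rw [hSl, inner_neg_left, hJ x, hJ, hSl, hP, hP, hJ', hKJ', hKJ]
      simp only [inner_neg_right]
      ring)
    (fun t h0 h1 => by
      obtain ⟨W, hW2, hW⟩ := hW t h0 h1
      refine ⟨W, hW2, fun x hx => ?_⟩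
      rw [hAr, hSr, real_inner_self_eq_norm_sq, real_inner_self_eq_norm_sq]
      exact hW x hx)
  rw [hSr, hP] at h1
  rw [hSr, hAr, real_inner_self_eq_norm_sq, real_inner_self_eq_norm_sq] at h2
  exact ⟨x, hx0, by linarith, h2⟩

end Abstract

/-! ### Real coordinates on a complex Euclidean space -/

section Halves

open scoped RealInnerProductSpace

variable {ι κ : Type*}

/-- The two halves of a vector indexed by a disjoint union. -/
noncomputable def euclideanHalves : EuclideanSpace ℝ (ι ⊕ κ) ≃ₗ[ℝ]
    EuclideanSpace ℝ ι × EuclideanSpace ℝ κ where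
  toFun x := (WithLp.toLp 2 fun i => x (Sum.inl i), WithLp.toLp 2 fun i => x (Sum.inr i))
  invFun y := WithLp.toLp 2 (Sum.elim y.1 y.2)
  map_add' _ _ := rfl
  map_smul' _ _ := rfl
  left_inv x := by ext (i | i) <;> rfl
  right_inv _ := rfl

theorem euclideanHalves_apply (x : EuclideanSpace ℝ (ι ⊕ κ)) : euclideanHalves x =
    (WithLp.toLp 2 fun i => x (Sum.inl i), WithLp.toLp 2 fun i => x (Sum.inr i)) :=
  rfl

theorem inner_eq_inner_euclideanHalves [Fintype ι] [Fintype κ] (x y : EuclideanSpace ℝ (ι ⊕ κ)) :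
    ⟪x, y⟫ = ⟪(euclideanHalves x).1, (euclideanHalves y).1⟫ +
      ⟪(euclideanHalves x).2, (euclideanHalves y).2⟫ := by
  simp [PiLp.inner_apply, euclideanHalves_apply]

theorem norm_sq_eq_norm_sq_euclideanHalves [Fintype ι] [Fintype κ]
    (x : EuclideanSpace ℝ (ι ⊕ κ)) :
    ‖x‖ ^ 2 = ‖(euclideanHalves x).1‖ ^ 2 + ‖(euclideanHalves x).2‖ ^ 2 := by
  simp only [← real_inner_self_eq_norm_sq, inner_eq_inner_euclideanHalves x]

/-- The complex structure `(a, b) ↦ (-b, a)`. -/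
noncomputable def halvesJ : EuclideanSpace ℝ (ι ⊕ ι) →ₗ[ℝ] EuclideanSpace ℝ (ι ⊕ ι) :=
  euclideanHalves.symm.toLinearMap ∘ₗ
    ((-LinearMap.snd ℝ _ _).prod (LinearMap.fst ℝ _ _)) ∘ₗ euclideanHalves.toLinearMap

/-- The conjugation `(a, b) ↦ (a, -b)`. -/
noncomputable def halvesConj : EuclideanSpace ℝ (ι ⊕ ι) →ₗ[ℝ] EuclideanSpace ℝ (ι ⊕ ι) :=
  euclideanHalves.symm.toLinearMap ∘ₗ
    ((LinearMap.fst ℝ _ _).prod (-LinearMap.snd ℝ _ _)) ∘ₗ euclideanHalves.toLinearMap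

@[simp]
theorem euclideanHalves_halvesJ (x : EuclideanSpace ℝ (ι ⊕ ι)) :
    euclideanHalves (halvesJ x) = (-(euclideanHalves x).2, (euclideanHalves x).1) := by
  simp [halvesJ]

@[simp]
theorem euclideanHalves_halvesConj (x : EuclideanSpace ℝ (ι ⊕ ι)) :
    euclideanHalves (halvesConj x) = ((euclideanHalves x).1, -(euclideanHalves x).2) := by
  simp [halvesConj]

theorem halvesJ_halvesJ (x : EuclideanSpace ℝ (ι ⊕ ι)) : halvesJ (halvesJ x) = -x :=
  euclideanHalves.injective (by simp; rfl)

theorem halvesConj_halvesJ (x : EuclideanSpace ℝ (ι ⊕ ι)) :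
    halvesConj (halvesJ x) = -halvesJ (halvesConj x) :=
  euclideanHalves.injective (by simp)

theorem inner_halvesJ_left [Fintype ι] (x y : EuclideanSpace ℝ (ι ⊕ ι)) :
    ⟪halvesJ x, y⟫ = -⟪x, halvesJ y⟫ := by
  simp [inner_eq_inner_euclideanHalves, add_comm]

theorem isSymmetric_halvesConj [Fintype ι] :
    (halvesConj : EuclideanSpace ℝ (ι ⊕ ι) →ₗ[ℝ] EuclideanSpace ℝ (ι ⊕ ι)).IsSymmetric := by
  intro x y
  simp [inner_eq_inner_euclideanHalves]

end Halves

/-! ### Realification of a complex matrix -/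

section RealBlock

open scoped RealInnerProductSpace

variable {p m : ℕ}

theorem euclideanHalves_realBlockMatrix (M : Matrix (Fin p) (Fin m) ℂ) (γ : ℝ)
    (x : EuclideanSpace ℝ (Fin m ⊕ Fin m)) :
    euclideanHalves (Matrix.toEuclideanLin (realBlockMatrix M γ) x) =
      (Matrix.toEuclideanLin (M.map Complex.re) (euclideanHalves x).1 -
          γ • Matrix.toEuclideanLin (M.map Complex.im) (euclideanHalves x).2,
        γ⁻¹ • Matrix.toEuclideanLin (M.map Complex.im) (euclideanHalves x).1 +
          Matrix.toEuclideanLin (M.map Complex.re) (euclideanHalves x).2) := by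
  ext i
  · simp [euclideanHalves_apply, realBlockMatrix, Matrix.toLpLin_apply, Matrix.fromBlocks_mulVec,
      Matrix.neg_mulVec, Matrix.smul_mulVec, Function.comp_def, sub_eq_add_neg]
  · simp [euclideanHalves_apply, realBlockMatrix, Matrix.toLpLin_apply, Matrix.fromBlocks_mulVec,
      Matrix.neg_mulVec, Matrix.smul_mulVec, Function.comp_def]

theorem realBlockMatrix_one_halvesJ (M : Matrix (Fin p) (Fin m) ℂ)
    (x : EuclideanSpace ℝ (Fin m ⊕ Fin m)) :
    Matrix.toEuclideanLin (realBlockMatrix M 1) (halvesJ x) =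
      halvesJ (Matrix.toEuclideanLin (realBlockMatrix M 1) x) := by
  apply euclideanHalves.injective
  simp [euclideanHalves_realBlockMatrix]
  abel_nf
  simp

/-- The scaling `(a, b) ↦ (γ a, b)`. -/
noncomputable def halvesScale {ι : Type*} (γ : ℝˣ) :
    EuclideanSpace ℝ (ι ⊕ ι) ≃ₗ[ℝ] EuclideanSpace ℝ (ι ⊕ ι) :=
  euclideanHalves ≪≫ₗ
    (LinearEquiv.smulOfUnit γ).prodCongr (LinearEquiv.refl ℝ _) ≪≫ₗ euclideanHalves.symm

theorem euclideanHalves_halvesScale {ι : Type*} (γ : ℝˣ) (x : EuclideanSpace ℝ (ι ⊕ ι)) :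
    euclideanHalves (halvesScale γ x) =
      ((γ : ℝ) • (euclideanHalves x).1, (euclideanHalves x).2) := by
  simp [halvesScale]
  rfl

/-- Thus varying `γ` only changes the norms in which a single complex-linear map is measured. -/
theorem realBlockMatrix_halvesScale (M : Matrix (Fin p) (Fin m) ℂ) (γ : ℝˣ)
    (x : EuclideanSpace ℝ (Fin m ⊕ Fin m)) :
    Matrix.toEuclideanLin (realBlockMatrix M γ) (halvesScale γ x) =
      halvesScale γ (Matrix.toEuclideanLin (realBlockMatrix M 1) x) := by
  apply euclideanHalves.injective
  simp [euclideanHalves_realBlockMatrix, euclideanHalves_halvesScale, smul_sub, smul_smul]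

/-- A kernel vector is split into real and imaginary parts; `D` is real, so it acts on each half
separately. -/
theorem det_one_sub_complexify_mul_eq_zero_iff (D : Matrix (Fin m) (Fin p) ℝ)
    (M : Matrix (Fin p) (Fin m) ℂ) :
    (1 - complexify D * M).det = 0 ↔ ∃ x : EuclideanSpace ℝ (Fin m ⊕ Fin m), x ≠ 0 ∧
      Matrix.toEuclideanLin D
        (euclideanHalves (Matrix.toEuclideanLin (realBlockMatrix M 1) x)).1 =
          (euclideanHalves x).1 ∧
      Matrix.toEuclideanLin D
        (euclideanHalves (Matrix.toEuclideanLin (realBlockMatrix M 1) x)).2 =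
          (euclideanHalves x).2 := by
  have hmul : ∀ v : Fin m → ℂ,
      (1 - complexify D * M).mulVec v = v - (complexify D).mulVec (M.mulVec v) := fun v => by
    rw [Matrix.sub_mulVec, Matrix.one_mulVec, Matrix.mulVec_mulVec]
  have hre : ∀ (v : Fin m → ℂ) i, (M.mulVec v i).re =
      (M.map Complex.re).mulVec (fun j => (v j).re) i -
        (M.map Complex.im).mulVec (fun j => (v j).im) i := fun v i => by
    simp [Matrix.mulVec, dotProduct, Complex.re_sum]
  have him : ∀ (v : Fin m → ℂ) i, (M.mulVec v i).im =
      (M.map Complex.im).mulVec (fun j => (v j).re) i +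
        (M.map Complex.re).mulVec (fun j => (v j).im) i := fun v i => by
    simp [Matrix.mulVec, dotProduct, Complex.im_sum, ← Finset.sum_add_distrib, add_comm]
  have hDre : ∀ (w : Fin p → ℂ) i, ((complexify D).mulVec w i).re =
      D.mulVec (fun j => (w j).re) i := fun w i => by
    simp [Matrix.mulVec, dotProduct, Complex.re_sum, complexify]
  have hDim : ∀ (w : Fin p → ℂ) i, ((complexify D).mulVec w i).im =
      D.mulVec (fun j => (w j).im) i := fun w i => by
    simp [Matrix.mulVec, dotProduct, Complex.im_sum, complexify]
  have hkey : ∀ v : Fin m → ℂ, (1 - complexify D * M).mulVec v = 0 ↔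
      D.mulVec ((M.map Complex.re).mulVec (fun j => (v j).re) -
        (M.map Complex.im).mulVec (fun j => (v j).im)) = (fun j => (v j).re) ∧
      D.mulVec ((M.map Complex.im).mulVec (fun j => (v j).re) +
        (M.map Complex.re).mulVec (fun j => (v j).im)) = (fun j => (v j).im) := by
    intro v
    rw [hmul, sub_eq_zero, eq_comm, funext_iff, funext_iff, funext_iff, ← forall_and]
    refine forall_congr' fun i => ?_
    rw [Complex.ext_iff, hDre, hDim]
    simp only [hre, him]
    rfl
  rw [← Matrix.exists_mulVec_eq_zero_iff]
  simp only [euclideanHalves_realBlockMatrix, one_smul, inv_one]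
  constructor
  · rintro ⟨v, hv0, hv⟩
    obtain ⟨h1, h2⟩ := (hkey v).1 hv
    refine ⟨euclideanHalves.symm (WithLp.toLp 2 fun j => (v j).re, WithLp.toLp 2 fun j => (v j).im),
      fun h => hv0 ?_, ?_, ?_⟩
    · rw [LinearEquiv.map_eq_zero_iff, Prod.mk_eq_zero] at h
      ext i
      exact Complex.ext (congrArg (fun y => y.ofLp i) h.1) (congrArg (fun y => y.ofLp i) h.2)
    · rw [LinearEquiv.apply_symm_apply]
      exact congrArg (WithLp.toLp 2) h1
    · rw [LinearEquiv.apply_symm_apply]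
      exact congrArg (WithLp.toLp 2) h2
  · rintro ⟨x, hx0, h1, h2⟩
    refine ⟨fun j => ⟨(euclideanHalves x).1 j, (euclideanHalves x).2 j⟩, fun h => hx0 ?_, ?_⟩
    · rw [← LinearEquiv.map_eq_zero_iff euclideanHalves]
      refine Prod.ext ?_ ?_
      · ext i; exact congrArg Complex.re (congrFun h i)
      · ext i; exact congrArg Complex.im (congrFun h i)
    · rw [hkey]
      exact ⟨congrArg WithLp.ofLp h1, congrArg WithLp.ofLp h2⟩

end RealBlock

/-! ### The formula for the real structured singular value -/

section RealStructuredSingularValue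

open scoped RealInnerProductSpace

variable {p m : ℕ}

theorem inv_matrixSpectralNorm_le_secondSingularValue (D : Matrix (Fin m) (Fin p) ℝ)
    (M : Matrix (Fin p) (Fin m) ℂ) (hD : (1 - complexify D * M).det = 0) {γ : ℝ} (hγ : 0 < γ) :
    0 < matrixSpectralNorm D ∧
      (matrixSpectralNorm D)⁻¹ ≤ secondSingularValue (realBlockMatrix M γ) := by
  obtain ⟨x, hx0, h1, h2⟩ := (det_one_sub_complexify_mul_eq_zero_iff D M).1 hD
  have hs : 0 < matrixSpectralNorm D := by
    refine (matrixSpectralNorm_nonneg D).lt_of_ne fun h => hx0 ?_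
    have h3 := norm_toEuclideanLin_le D
    simp only [← h, zero_mul, norm_le_zero_iff] at h3
    rw [← LinearEquiv.map_eq_zero_iff euclideanHalves]
    exact Prod.ext (h1.symm.trans (h3 _)) (h2.symm.trans (h3 _))
  refine ⟨hs, ?_⟩
  have hJx0 : halvesJ x ≠ 0 := fun h => hx0 (by
    have := halvesJ_halvesJ x
    rwa [h, map_zero, eq_comm, neg_eq_zero] at this)
  have hskew : ⟪x, halvesJ x⟫ = 0 := by
    have := inner_halvesJ_left x x
    rw [real_inner_comm] at this
    linarith
  have hfix : ∀ y ∈ Submodule.span ℝ {x, halvesJ x},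
      Matrix.toEuclideanLin D
        (euclideanHalves (Matrix.toEuclideanLin (realBlockMatrix M 1) y)).1 =
          (euclideanHalves y).1 ∧
      Matrix.toEuclideanLin D
        (euclideanHalves (Matrix.toEuclideanLin (realBlockMatrix M 1) y)).2 =
          (euclideanHalves y).2 := by
    intro y hy
    obtain ⟨s, t, rfl⟩ := Submodule.mem_span_pair.1 hy
    simp only [map_add, map_smul, realBlockMatrix_one_halvesJ, euclideanHalves_halvesJ,
      Prod.fst_add, Prod.snd_add, Prod.smul_fst, Prod.smul_snd, map_neg, h1, h2, and_self]
  obtain ⟨u, rfl⟩ : ∃ u : ℝˣ, (u : ℝ) = γ := ⟨Units.mk0 γ hγ.ne', rfl⟩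
  -- `D` acts identically on both halves and so respects the scaling; on the scaled plane it
  -- recovers each vector from its image under the block matrix.
  refine le_secondSingularValue _
    (W := (Submodule.span ℝ {x, halvesJ x}).map (halvesScale u).toLinearMap) ?_ ?_
  · rw [LinearEquiv.finrank_map_eq]
    exact two_le_finrank_span_pair hx0 hJx0 hskew
  · rintro _ ⟨y, hy, rfl⟩
    obtain ⟨h3, h4⟩ := hfix y hy
    rw [LinearEquiv.coe_coe, realBlockMatrix_halvesScale, norm_sq_eq_norm_sq_euclideanHalves,
      norm_sq_eq_norm_sq_euclideanHalves (halvesScale u _), euclideanHalves_halvesScale,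
      euclideanHalves_halvesScale, ← h3, ← h4]
    set c := (euclideanHalves (Matrix.toEuclideanLin (realBlockMatrix M 1) y)).1
    set d := (euclideanHalves (Matrix.toEuclideanLin (realBlockMatrix M 1) y)).2
    have h5 := pow_le_pow_left₀ (norm_nonneg _) (norm_toEuclideanLin_le D c) 2
    have h6 := pow_le_pow_left₀ (norm_nonneg _) (norm_toEuclideanLin_le D d) 2
    rw [inv_pow, inv_mul_le_iff₀ (by positivity)]
    simp only [norm_smul, mul_pow] at h5 h6 ⊢
    nlinarith [mul_le_mul_of_nonneg_left h5 (sq_nonneg ‖(u : ℝ)‖)]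

/-- For `γ² = (1 - t) / (1 + t)` the weights `γ²` and `1` of the two halves become `1 - t` and `1 +
t` after multiplication by `1 + t`; this is the form of `1 - t K`, with `K` the conjugation. -/
theorem exists_submodule_form_nonneg (M : Matrix (Fin p) (Fin m) ℂ) {σ : ℝ} (hσ : 0 < σ)
    (h : ∀ γ ∈ Set.Ioc (0 : ℝ) 1, σ ≤ secondSingularValue (realBlockMatrix M γ))
    (t : ℝ) (ht0 : 0 ≤ t) (ht1 : t < 1) :
    ∃ W : Submodule ℝ (EuclideanSpace ℝ (Fin m ⊕ Fin m)), 2 ≤ Module.finrank ℝ W ∧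
      ∀ x ∈ W, 0 ≤ ‖Matrix.toEuclideanLin (realBlockMatrix M 1) x‖ ^ 2 - σ ^ 2 * ‖x‖ ^ 2 -
        t * (⟪Matrix.toEuclideanLin (realBlockMatrix M 1) x,
          halvesConj (Matrix.toEuclideanLin (realBlockMatrix M 1) x)⟫ -
            σ ^ 2 * ⟪x, halvesConj x⟫) := by
  have hq : 0 < (1 - t) / (1 + t) := div_pos (by linarith) (by linarith)
  have hγ0 : 0 < √((1 - t) / (1 + t)) := Real.sqrt_pos.2 hq
  have hγ2 : (1 + t) * √((1 - t) / (1 + t)) ^ 2 = 1 - t := by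
    rw [Real.sq_sqrt hq.le]
    exact mul_div_cancel₀ _ (by linarith)
  obtain ⟨u, hu⟩ : ∃ u : ℝˣ, (u : ℝ) = √((1 - t) / (1 + t)) := ⟨Units.mk0 _ hγ0.ne', rfl⟩
  have hγ1 : √((1 - t) / (1 + t)) ≤ 1 := by
    rw [Real.sqrt_le_iff, one_pow, div_le_one (by linarith)]
    exact ⟨zero_le_one, by linarith⟩
  obtain ⟨W, hW2, hW⟩ := exists_submodule_of_le_secondSingularValue _ hσ (h _ ⟨hγ0, hγ1⟩)
  refine ⟨W.map (halvesScale u).symm.toLinearMap,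
    by rwa [LinearEquiv.finrank_map_eq], ?_⟩
  rintro _ ⟨z, hz, rfl⟩
  rw [LinearEquiv.coe_coe]
  obtain ⟨y, rfl⟩ := (halvesScale u).surjective z
  have h1 := hW _ hz
  rw [LinearEquiv.symm_apply_apply]
  rw [← hu] at h1 hγ2
  rw [realBlockMatrix_halvesScale, norm_sq_eq_norm_sq_euclideanHalves,
    norm_sq_eq_norm_sq_euclideanHalves (halvesScale u _), euclideanHalves_halvesScale,
    euclideanHalves_halvesScale] at h1
  simp only [norm_smul, mul_pow, Real.norm_eq_abs, sq_abs] at h1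
  rw [norm_sq_eq_norm_sq_euclideanHalves, norm_sq_eq_norm_sq_euclideanHalves y,
    inner_eq_inner_euclideanHalves, inner_eq_inner_euclideanHalves y,
    euclideanHalves_halvesConj, euclideanHalves_halvesConj]
  simp only [inner_neg_right, real_inner_self_eq_norm_sq]
  have h2 := mul_le_mul_of_nonneg_left h1 (show 0 ≤ 1 + t by linarith)
  simp only [mul_add, mul_left_comm (1 + t) (σ ^ 2)] at h2
  simp only [← mul_assoc, hγ2] at h2
  linarith

theorem exists_matrix_of_le_secondSingularValue (M : Matrix (Fin p) (Fin m) ℂ) {σ : ℝ}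
    (hσ : 0 < σ)
    (h : ∀ γ ∈ Set.Ioc (0 : ℝ) 1, σ ≤ secondSingularValue (realBlockMatrix M γ)) :
    ∃ D : Matrix (Fin m) (Fin p) ℝ, (1 - complexify D * M).det = 0 ∧
      matrixSpectralNorm D ≤ σ⁻¹ := by
  obtain ⟨x, hx0, hcross, habs⟩ := exists_abs_le_norm_sq_sub
    (halvesJ (ι := Fin m)) halvesConj (halvesJ (ι := Fin p)) halvesConj
    (Matrix.toEuclideanLin (realBlockMatrix M 1)) halvesJ_halvesJ inner_halvesJ_left
    inner_halvesJ_left isSymmetric_halvesConj isSymmetric_halvesConj halvesConj_halvesJ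
    halvesConj_halvesJ (realBlockMatrix_one_halvesJ M) (σ ^ 2) (exists_submodule_form_nonneg M hσ h)
  set y := Matrix.toEuclideanLin (realBlockMatrix M 1) x with hy
  simp only [inner_eq_inner_euclideanHalves, norm_sq_eq_norm_sq_euclideanHalves,
    euclideanHalves_halvesConj, euclideanHalves_halvesJ, inner_neg_right,
    real_inner_self_eq_norm_sq] at hcross habs
  rw [abs_le] at habs
  rw [real_inner_comm (euclideanHalves y).1, real_inner_comm (euclideanHalves x).1] at hcross
  obtain ⟨D, hDa, hDb, hD, -⟩ := exists_matrix_of_norm_le (euclideanHalves x).1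
    (euclideanHalves x).2 (euclideanHalves y).1 (euclideanHalves y).2 (δ := σ⁻¹) (by positivity)
    fun s t => by
      rw [← div_eq_inv_mul, le_div_iff₀ hσ]
      refine le_of_sq_le_sq ?_ (norm_nonneg _)
      rw [mul_pow, norm_add_sq_real, norm_add_sq_real]
      simp only [norm_smul, mul_pow, Real.norm_eq_abs, sq_abs, real_inner_smul_left,
        real_inner_smul_right]
      -- The two sides of `habs` give `e1` and `e2`, and `hcross` gives `e3`: the difference of the
      -- Gram matrices is diagonal with nonnegative entries.
      have e1 : σ ^ 2 * ‖(euclideanHalves x).1‖ ^ 2 ≤ ‖(euclideanHalves y).1‖ ^ 2 := by linarith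
      have e2 : σ ^ 2 * ‖(euclideanHalves x).2‖ ^ 2 ≤ ‖(euclideanHalves y).2‖ ^ 2 := by linarith
      have e3 : ⟪(euclideanHalves y).1, (euclideanHalves y).2⟫ =
          σ ^ 2 * ⟪(euclideanHalves x).1, (euclideanHalves x).2⟫ := by linarith
      rw [e3]
      linarith [mul_le_mul_of_nonneg_left e1 (sq_nonneg s),
        mul_le_mul_of_nonneg_left e2 (sq_nonneg t)]
  exact ⟨D, (det_one_sub_complexify_mul_eq_zero_iff D M).2 ⟨x, hx0, hDa, hDb⟩, hD⟩

/-- The formula of Qiu, Bernhardsson, Rantzer, Davison, Young and Doyle for the real structured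
singular value. -/
theorem muRealTwo_eq_iInf_secondSingularValue (M : Matrix (Fin p) (Fin m) ℂ) :
    muRealTwo M = ⨅ γ ∈ Set.Ioc (0 : ℝ) 1,
      ENNReal.ofReal (secondSingularValue (realBlockMatrix M γ)) := by
  apply le_antisymm
  · refine le_iInf₂ fun γ hγ => ?_
    rw [muRealTwo, ENNReal.inv_le_iff_inv_le]
    refine le_sInf ?_
    rintro _ ⟨D, hD, rfl⟩
    obtain ⟨h1, h2⟩ := inv_matrixSpectralNorm_le_secondSingularValue D M hD hγ.1
    rw [ENNReal.inv_le_iff_inv_le, ← ENNReal.ofReal_inv_of_pos h1]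
    exact ENNReal.ofReal_le_ofReal h2
  · set I := ⨅ γ ∈ Set.Ioc (0 : ℝ) 1, ENNReal.ofReal (secondSingularValue (realBlockMatrix M γ))
      with hI
    have hle : ∀ γ ∈ Set.Ioc (0 : ℝ) 1,
        I ≤ ENNReal.ofReal (secondSingularValue (realBlockMatrix M γ)) :=
      fun γ hγ => iInf₂_le γ hγ
    have htop : I ≠ ⊤ := ((hle 1 (by simp)).trans_lt ENNReal.ofReal_lt_top).ne
    rcases eq_or_ne I 0 with h0 | h0
    · rw [h0]; exact zero_le
    have hpos : 0 < I.toReal := ENNReal.toReal_pos h0 htop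
    obtain ⟨D, hD, hDle⟩ := exists_matrix_of_le_secondSingularValue M hpos fun γ hγ =>
      ENNReal.toReal_le_of_le_ofReal (LinearMap.singularValues_nonneg _ _) (hle γ hγ)
    rw [muRealTwo, ENNReal.le_inv_iff_le_inv]
    refine le_trans (sInf_le ⟨D, hD, rfl⟩) ?_
    rw [← ENNReal.ofReal_toReal htop, ← ENNReal.ofReal_inv_of_pos hpos]
    exact ENNReal.ofReal_le_ofReal hDle

/-- A singularizing real matrix may be replaced by one of rank at most two. -/
theorem exists_frobeniusNorm_sq_le (D : Matrix (Fin m) (Fin p) ℝ) (M : Matrix (Fin p) (Fin m) ℂ)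
    (hD : (1 - complexify D * M).det = 0) :
    ∃ D' : Matrix (Fin m) (Fin p) ℝ, (1 - complexify D' * M).det = 0 ∧
      frobeniusNorm D' ^ 2 ≤ 2 * matrixSpectralNorm D ^ 2 := by
  obtain ⟨x, hx0, h1, h2⟩ := (det_one_sub_complexify_mul_eq_zero_iff D M).1 hD
  obtain ⟨D', h3, h4, -, h5⟩ := exists_matrix_of_norm_le _ _
    (euclideanHalves (Matrix.toEuclideanLin (realBlockMatrix M 1) x)).1
    (euclideanHalves (Matrix.toEuclideanLin (realBlockMatrix M 1) x)).2
    (matrixSpectralNorm_nonneg D) fun s t => by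
      have := norm_toEuclideanLin_le D
        (s • (euclideanHalves (Matrix.toEuclideanLin (realBlockMatrix M 1) x)).1 +
          t • (euclideanHalves (Matrix.toEuclideanLin (realBlockMatrix M 1) x)).2)
      rwa [map_add, map_smul, map_smul, h1, h2] at this
  exact ⟨D', (det_one_sub_complexify_mul_eq_zero_iff D' M).2 ⟨x, hx0, h3, h4⟩, h5⟩

end RealStructuredSingularValue

/-! ### Asymptotic stability excludes imaginary eigenvalues -/

section Stability

theorem complexify_mul {k l n : ℕ} (A : Matrix (Fin k) (Fin l) ℝ) (B : Matrix (Fin l) (Fin n) ℝ) :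
    complexify (A * B) = complexify A * complexify B :=
  Matrix.map_mul (f := Complex.ofRealHom)

theorem complexify_add {k l : ℕ} (A B : Matrix (Fin k) (Fin l) ℝ) :
    complexify (A + B) = complexify A + complexify B := by
  ext; simp [complexify]

theorem mem_eigenvalueSet_iff {n : ℕ} (A : Matrix (Fin n) (Fin n) ℂ) (z : ℂ) :
    z ∈ eigenvalueSet A ↔ (z • (1 : Matrix (Fin n) (Fin n) ℂ) - A).det = 0 := by
  rw [← Matrix.exists_mulVec_eq_zero_iff]
  have hmul : ∀ v : Fin n → ℂ, (z • (1 : Matrix (Fin n) (Fin n) ℂ) - A).mulVec v = 0 ↔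
      Matrix.toLin' A v = z • v := fun v => by
    rw [Matrix.sub_mulVec, Matrix.smul_mulVec, Matrix.one_mulVec, sub_eq_zero, eq_comm,
      Matrix.toLin'_apply]
  simp only [hmul]
  constructor
  · intro h
    obtain ⟨v, hv⟩ := Module.End.HasEigenvalue.exists_hasEigenvector h
    exact ⟨v, hv.2, hv.apply_eq_smul⟩
  · rintro ⟨v, hv0, hv⟩
    exact Module.End.hasEigenvalue_of_hasEigenvector
      (Module.End.hasEigenvector_iff.2 ⟨Module.End.mem_eigenspace_iff.2 hv, hv0⟩)

/-- The harmonic trajectory belonging to an eigenvalue `i w`. -/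
theorem isTrajectory_harmonic {n : ℕ} {A : Matrix (Fin n) (Fin n) ℝ} {w : ℝ}
    {a b : EuclideanSpace ℝ (Fin n)} (ha : Matrix.toEuclideanLin A a = -(w • b))
    (hb : Matrix.toEuclideanLin A b = w • a) (ε t₀ : ℝ) :
    IsTrajectory A t₀ fun t => ε • (Real.cos (w * t) • a - Real.sin (w * t) • b) := by
  intro t _
  have h0 : HasDerivAt (fun t => w * t) w t := by simpa using (hasDerivAt_id t).const_mul w
  have h1 := ((h0.cos.smul_const a).sub (h0.sin.smul_const b)).const_smul ε
  refine h1.hasDerivWithinAt.congr_deriv ?_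
  rw [map_smul, map_sub, map_smul, map_smul, ha, hb]
  module

/-- An asymptotically stable system has no harmonic solutions. -/
theorem IsAsymptoticallyStable.eq_zero_of_harmonic {n : ℕ} {A : Matrix (Fin n) (Fin n) ℝ}
    (hA : IsAsymptoticallyStable A) {w : ℝ} {a b : EuclideanSpace ℝ (Fin n)}
    (ha : Matrix.toEuclideanLin A a = -(w • b)) (hb : Matrix.toEuclideanLin A b = w • a) :
    a = 0 := by
  obtain ⟨-, δ, hδ, h⟩ := hA 0
  obtain ⟨ε, hε, hεa, hεb⟩ : ∃ ε : ℝ, 0 < ε ∧ ε * ‖a‖ < δ ∧ ε * ‖b‖ < δ := by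
    have hpos : 0 < ‖a‖ + ‖b‖ + 1 := by positivity
    refine ⟨δ / (‖a‖ + ‖b‖ + 1), by positivity, ?_, ?_⟩
    · rw [div_mul_eq_mul_div, div_lt_iff₀ hpos]
      nlinarith [norm_nonneg b]
    · rw [div_mul_eq_mul_div, div_lt_iff₀ hpos]
      nlinarith [norm_nonneg a]
  have h1 := h _ (isTrajectory_harmonic ha hb ε 0) (by simpa [norm_smul, abs_of_pos hε] using hεa)
  have h2 := h _ (isTrajectory_harmonic (a := b) (b := -a) (w := w) (by simpa using hb)
    (by rw [map_neg, ha, neg_neg]) ε 0) (by simpa [norm_smul, abs_of_pos hε] using hεb)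
  have hzero : ∀ f : ℝ → ℝ, (∀ t, |f t| ≤ 1) → ∀ x : ℝ → EuclideanSpace ℝ (Fin n),
      Filter.Tendsto x Filter.atTop (nhds 0) →
      Filter.Tendsto (fun t => f t • x t) Filter.atTop (nhds 0) := fun f hf x hx => by
    refine squeeze_zero_norm (fun t => ?_) (tendsto_zero_iff_norm_tendsto_zero.1 hx)
    rw [norm_smul]
    exact mul_le_of_le_one_left (norm_nonneg _) (hf t)
  have h3 := (hzero (fun t => Real.cos (w * t)) (fun t => Real.abs_cos_le_one _) _ h1).add
    (hzero (fun t => Real.sin (w * t)) (fun t => Real.abs_sin_le_one _) _ h2)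
  -- Combining the solution with its quarter-period shift, with bounded coefficients, leaves the
  -- constant `ε • a`, although both solutions decay.
  have h4 : ∀ t : ℝ, Real.cos (w * t) • ε • (Real.cos (w * t) • a - Real.sin (w * t) • b) +
      Real.sin (w * t) • ε • (Real.cos (w * t) • b - Real.sin (w * t) • -a) = ε • a := fun t => by
    have h5 := Real.sin_sq_add_cos_sq (w * t)
    have h6 : ε • a = (ε * (Real.sin (w * t) ^ 2 + Real.cos (w * t) ^ 2)) • a := by
      rw [h5, mul_one]
    rw [h6]
    module
  simp only [h4, add_zero] at h3
  exact (smul_eq_zero.1 (tendsto_nhds_unique tendsto_const_nhds h3)).resolve_left hε.ne'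

theorem IsAsymptoticallyStable.isUnit_det {n : ℕ} {A : Matrix (Fin n) (Fin n) ℝ}
    (hA : IsAsymptoticallyStable A) (w : ℝ) :
    IsUnit ((Complex.I * (w : ℂ)) • (1 : Matrix (Fin n) (Fin n) ℂ) - complexify A).det := by
  rw [isUnit_iff_ne_zero]
  intro hdet
  obtain ⟨v, hv0, hv⟩ := Matrix.exists_mulVec_eq_zero_iff.2 hdet
  rw [Matrix.sub_mulVec, Matrix.smul_mulVec, Matrix.one_mulVec, sub_eq_zero, eq_comm] at hv
  have hre : A.mulVec (fun j => (v j).re) = -(w • fun j => (v j).im) := by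
    ext i
    have := congrArg Complex.re (congrFun hv i)
    simpa [Matrix.mulVec, dotProduct, Complex.re_sum, complexify] using this
  have him : A.mulVec (fun j => (v j).im) = w • fun j => (v j).re := by
    ext i
    have := congrArg Complex.im (congrFun hv i)
    simpa [Matrix.mulVec, dotProduct, Complex.im_sum, complexify] using this
  have ha := congrArg (WithLp.toLp 2) hre
  have hb := congrArg (WithLp.toLp 2) him
  have h1 : WithLp.toLp 2 (fun j => (v j).re) = 0 := hA.eq_zero_of_harmonic (w := w)
    (a := WithLp.toLp 2 fun j => (v j).re) (b := WithLp.toLp 2 fun j => (v j).im) ha hb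
  -- The same argument for the eigenvector `-i v`.
  have h2 : WithLp.toLp 2 (fun j => (v j).im) = 0 := hA.eq_zero_of_harmonic (w := w)
    (a := WithLp.toLp 2 fun j => (v j).im) (b := -WithLp.toLp 2 fun j => (v j).re)
    (by rw [smul_neg, neg_neg]; exact hb) 
    (by rw [map_neg]; exact (congrArg Neg.neg ha).trans (neg_neg _))
  refine hv0 (funext fun i => Complex.ext ?_ ?_)
  · exact congrArg (fun y => y.ofLp i) h1
  · exact congrArg (fun y => y.ofLp i) h2

end Stability

/-! ### From the stability radius to singularity of `1 - Δ G(w)` -/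

section Radius

variable {n r q : ℕ}

theorem det_one_sub_complexify_mul_transferFunction_eq_zero_iff (J R Q : Matrix (Fin n) (Fin n) ℝ)
    (B : Matrix (Fin n) (Fin r) ℝ) (C : Matrix (Fin q) (Fin n) ℝ) (w : ℝ)
    (hw : IsUnit ((Complex.I * (w : ℂ)) • (1 : Matrix (Fin n) (Fin n) ℂ) -
      complexify ((J - R) * Q)).det) (D : Matrix (Fin r) (Fin q) ℝ) :
    (1 - complexify D * transferFunction J R Q B C w).det = 0 ↔
      Complex.I * (w : ℂ) ∈ eigenvalueSet (complexify ((J - R) * Q + B * D * C * Q)) := by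
  rw [mem_eigenvalueSet_iff, complexify_add, complexify_mul (B * D * C), complexify_mul (B * D),
    complexify_mul B, transferFunction]
  set K := (Complex.I * (w : ℂ)) • (1 : Matrix (Fin n) (Fin n) ℂ) - complexify ((J - R) * Q)
  have h1 : (1 - complexify D * (complexify C * complexify Q * K⁻¹ * complexify B)).det =
      (K - complexify B * complexify D * complexify C * complexify Q).det * (K⁻¹).det := by
    rw [← Matrix.mul_assoc, Matrix.det_one_sub_mul_comm, ← Matrix.det_mul, Matrix.sub_mul,
      Matrix.mul_nonsing_inv _ hw]
    simp only [Matrix.mul_assoc]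
  rw [h1, sub_add_eq_sub_sub, mul_eq_zero, or_iff_left]
  exact ((Matrix.isUnit_nonsing_inv_det_iff).2 hw).ne_zero

theorem nonempty_eigenvalueSet_inter_imaginaryAxis_iff (J R Q : Matrix (Fin n) (Fin n) ℝ)
    (hstable : IsAsymptoticallyStable ((J - R) * Q))
    (B : Matrix (Fin n) (Fin r) ℝ) (C : Matrix (Fin q) (Fin n) ℝ) (D : Matrix (Fin r) (Fin q) ℝ) :
    (eigenvalueSet (complexify ((J - R) * Q + B * D * C * Q)) ∩ imaginaryAxis).Nonempty ↔
      ∃ w : ℝ, (1 - complexify D * transferFunction J R Q B C w).det = 0 := by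
  constructor
  · rintro ⟨_, hz, w, rfl⟩
    exact ⟨w, (det_one_sub_complexify_mul_transferFunction_eq_zero_iff J R Q B C w
      (hstable.isUnit_det w) D).2 hz⟩
  · rintro ⟨w, hw⟩
    exact ⟨_, (det_one_sub_complexify_mul_transferFunction_eq_zero_iff J R Q B C w
      (hstable.isUnit_det w) D).1 hw, w, rfl⟩

end Radius

theorem mainTheorem8 {n r q : ℕ} (J R Q : Matrix (Fin n) (Fin n) ℝ)
    (hJ : J.transpose = -J) (hR : R.PosSemidef) (hQ : Q.PosDef)
    (hstable : IsAsymptoticallyStable ((J - R) * Q))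
    (B : Matrix (Fin n) (Fin r) ℝ) (C : Matrix (Fin q) (Fin n) ℝ) :
    ENNReal.ofReal (1 / Real.sqrt 2) * (⨅ w : ℝ, (muRealTwo (transferFunction J R Q B C w))⁻¹)
        ≤ realUnstructuredRadius J R Q B C ∧
      realUnstructuredRadius J R Q B C
        ≤ ⨅ w : ℝ, (muRealTwo (transferFunction J R Q B C w))⁻¹ ∧
      ∀ w : ℝ, muRealTwo (transferFunction J R Q B C w) =
        ⨅ γ ∈ Set.Ioc (0 : ℝ) 1,
          ENNReal.ofReal
            (secondSingularValue (realBlockMatrix (transferFunction J R Q B C w) γ)) := by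
  refine ⟨?_, ?_, fun w => muRealTwo_eq_iInf_secondSingularValue _⟩
  · refine le_sInf ?_
    rintro _ ⟨ΔJ, ΔR, hne, rfl⟩
    obtain ⟨w, hw⟩ := (nonempty_eigenvalueSet_inter_imaginaryAxis_iff J R Q hstable B C _).1 hne
    have h1 : (⨅ w : ℝ, (muRealTwo (transferFunction J R Q B C w))⁻¹) ≤
        ENNReal.ofReal (matrixSpectralNorm (ΔJ - ΔR)) := by
      refine (iInf_le _ w).trans ?_
      rw [muRealTwo, inv_inv]
      exact sInf_le ⟨_, hw, rfl⟩
    refine (mul_le_mul_right h1 _).trans ?_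
    rw [← ENNReal.ofReal_mul (by positivity)]
    refine ENNReal.ofReal_le_ofReal (Real.le_sqrt_of_sq_le ?_)
    rw [mul_pow, div_pow, Real.sq_sqrt zero_le_two]
    have h2 := pow_le_pow_left₀ (matrixSpectralNorm_nonneg _)
      (matrixSpectralNorm_le_frobeniusNorm (ΔJ - ΔR)) 2
    linarith [frobeniusNorm_sub_sq_le ΔJ ΔR]
  · refine le_iInf fun w => ?_
    rw [muRealTwo, inv_inv]
    refine le_sInf ?_
    rintro _ ⟨D, hD, rfl⟩
    obtain ⟨D', hD', hle⟩ := exists_frobeniusNorm_sq_le D _ hD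
    -- The even split has cost `‖D'‖_F² / 2`, at most `‖D‖₂²` by the rank-two bound.
    have hsub : (1 / 2 : ℝ) • D' - -((1 / 2 : ℝ) • D') = D' := by module
    refine le_trans (sInf_le ⟨(1 / 2 : ℝ) • D', -((1 / 2 : ℝ) • D'), ?_, rfl⟩)
      (ENNReal.ofReal_le_ofReal ?_)
    · rw [hsub]
      exact (nonempty_eigenvalueSet_inter_imaginaryAxis_iff J R Q hstable B C _).2 ⟨w, hD'⟩
    · refine Real.sqrt_le_iff.2 ⟨matrixSpectralNorm_nonneg D, ?_⟩
      simp only [frobeniusNorm_sq, Matrix.neg_apply, Matrix.smul_apply, smul_eq_mul, neg_sq,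
        mul_pow, ← Finset.mul_sum] at hle ⊢
      linarith
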